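/- Let $\beta>1$ be a Pisot unit, i.e. a real algebraic integer all of whose other conjugates have modulus $<1$ and whose minimal polynomial $g(x)=x^m-k_1x^{m-1}-\dots-k_m\in\mathbb Z[x]$ satisfies $k_m=\pm1$. The greedy digits of $x$ are $\varepsilon_1(x)=\lfloor\beta x\rfloor$, $\varepsilon_2(x)=\lfloor\beta\{\beta x\}\rfloor$, and so on; for $x\in[0,1)$ they form the $\beta$-expansion $x=\sum_{k\ge1}\varepsilon_k(x)\beta^{-k}$, and the expansion is extended to all reals $x\ge0$, as a two-sided sequence with only zeros far to the left, by expanding $x\beta^{-N}\in[0,1)$ and shifting by $N$ places. Assume that $\beta$ is finitary: the $x\in[0,1)$ with finite $\beta$-expansion are exactly the elements of $\mathbb Z[\beta]\cap[0,1)$. Let $(d'_n)_{n\ge1}$ be the greedy digits of $1$. Put $d=d'$ if $d'$ has infinitely many nonzero terms, and otherwise let $d$ be the periodic sequence with period $d'_1,\dots,d'_{k-1},d'_k-1$, where $d'_k$ is the last nonzero digit. Let $X_\beta$ be the set of two-sided sequences $\varepsilon=(\varepsilon_n)_{n\in\mathbb Z}$ of nonnegative integers such that $(\varepsilon_n,\varepsilon_{n+1},\dots)$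 is strictly lexicographically smaller than $(d_1,d_2,\dots)$ for every $n\in\mathbb Z$. Let $T$ be the automorphism of $\mathbb T^m=\mathbb R^m/\mathbb Z^m$ given by the companion matrix of $g$ with first row $(k_1,\dots,k_m)$ and ones below the diagonal, let $\xi_0=1/g'(\beta)$, and for $\varepsilon\in X_\beta$ put $$\varphi_0(\varepsilon)=\sum_{k\in\mathbb Z}\varepsilon_kT^{-k}(\xi_0,\xi_0\beta^{-1},\dots,\xi_0\beta^{-m+1}),\qquad \varphi(\varepsilon)=\sum_{k\in\mathbb Z}\varepsilon_kT^{-k}(1,\beta^{-1},\dots,\beta^{-m+1})$$ in $\mathbb T^m$. Write $\varepsilon\sim\varepsilon'$ if $\varphi_0(\varepsilon)=\varphi_0(\varepsilon')$, and let $X'_\beta=X_\beta/{\sim}$. Let $\mathcal P_\beta=\{\xi\in\mathbb R:\|\xi\beta^n\|\to0\text{ as }n\to+\infty\}$, where $\|\cdot\|$ is the distance to the nearest integer, and let $\mathcal A_\beta=\mathcal P_\beta/\mathbb Z[\beta]$ be the Pisot group. For $a\in\mathcal A_\beta$ let $\mathfrak g(a)\subset X_\beta$ be the set of all purely periodic sequences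 in $X_\beta$ that agree at all sufficiently large indices with the $\beta$-expansion of some nonnegative $\xi\in a$. The symbolic Pisot group is $\mathfrak A_\beta=\{\mathfrak g(a):a\in\mathcal A_\beta\}$, with the addition carried over from $\mathcal A_\beta$ by $\mathfrak g$. Theorem. The series defining $\varphi_0$ and $\varphi$ converge, $\varphi_0$ induces a bijection $X'_\beta\to\mathbb T^m$, and $X'_\beta$ is given the group structure carried over from $\mathbb T^m$ by this bijection. Then: (1) $\varphi$ is well defined on $X'_\beta$: if $\varphi_0(\varepsilon)=\varphi_0(\varepsilon')$, then $\varphi(\varepsilon)=\varphi(\varepsilon')$. (2) The induced map $\varphi:X'_\beta\to\mathbb T^m$ is a group homomorphism, and its kernel is equal to $\mathfrak A_\beta$: the $\sim$-classes that form the kernel are exactly the sets $\mathfrak g(a)$, $a\in\mathcal A_\beta$, and $a\mapsto\mathfrak g(a)$ is a group isomorphism of $\mathcal A_\beta$ onto the kernel. -/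

import Mathlib

open Polynomial Filter Topology

namespace PisotCoding

/-! ### Pisot units -/

/-- `β > 1` is an algebraic integer all of whose other conjugates have modulus `< 1`, and the
constant coefficient of its minimal polynomial is `±1`. -/
structure IsPisotUnit (β : ℝ) : Prop where
  one_lt : 1 < β
  isIntegral : IsIntegral ℤ β
  conj_lt : ∀ z : ℂ, aeval z (minpoly ℤ β) = 0 → z ≠ (β : ℂ) → ‖z‖ < 1
  unit : IsUnit ((minpoly ℤ β).coeff 0)

/-- The degree `m` of `β`. -/
noncomputable def deg (β : ℝ) : ℕ := (minpoly ℤ β).natDegree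

/-- The ring `ℤ[β]`, as an additive subgroup of `ℝ`. -/
noncomputable def ringZ (β : ℝ) : AddSubgroup ℝ :=
  (Algebra.adjoin ℤ ({β} : Set ℝ)).toSubring.toAddSubgroup

/-! ### The Pisot group -/

/-- `𝒫_β = {ξ ∈ ℝ : ‖ξ βⁿ‖ → 0 as n → +∞}`, where the distance to the nearest integer is the norm
of the image in `ℝ/ℤ`. -/
noncomputable def pisotP (β : ℝ) : AddSubgroup ℝ where
  carrier := {ξ | Tendsto (fun n : ℕ => ‖((ξ * β ^ n : ℝ) : UnitAddCircle)‖) atTop (𝓝 0)}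
  zero_mem' := by simp
  add_mem' := by
    intro a b ha hb
    have h := Tendsto.add ha hb
    rw [add_zero] at h
    refine squeeze_zero (fun _ => norm_nonneg _) (fun n => ?_) h
    rw [add_mul, AddCircle.coe_add]
    exact norm_add_le _ _
  neg_mem' := by
    intro a ha
    simpa [neg_mul, AddCircle.coe_neg] using ha

/-- The Pisot group `𝒜_β = 𝒫_β / ℤ[β]`. -/
abbrev PisotGroup (β : ℝ) : Type :=
  pisotP β ⧸ (ringZ β).addSubgroupOf (pisotP β)

/-! ### `β`-expansions and the two-sided `β`-compactum -/

/-- The digits of the greedy algorithm started at `x`, indexed from `0`: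
`digit β x n` is `ε_{n+1}(x)`, that is `ε₁ = [βx]`, `ε₂ = [β{βx}]`, and so on. -/
noncomputable def digit (β x : ℝ) (n : ℕ) : ℕ :=
  ⌊β * (fun y : ℝ => Int.fract (β * y))^[n] x⌋₊

/-- `β` is finitary: the elements of `[0,1)` with a finite greedy expansion are exactly those of
`ℤ[β] ∩ [0,1)`. -/
def IsFinitary (β : ℝ) : Prop :=
  {x : ℝ | x ∈ Set.Ico (0 : ℝ) 1 ∧ ∃ K, ∀ n ≥ K, digit β x n = 0} =
    (ringZ β : Set ℝ) ∩ Set.Ico (0 : ℝ) 1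

open Classical in
/-- The sequence `d` (indexed from `0`): the greedy expansion `d'` of `1` if that is infinite; if
`d'` has last nonzero digit `d'_k`, the periodic sequence with period
`d'_1, …, d'_{k-1}, d'_k - 1`. -/
noncomputable def quasiGreedy (β : ℝ) (n : ℕ) : ℕ :=
  if h : ∃ K, ∀ j ≥ K, digit β 1 j = 0 then
    if n % Nat.find h + 1 = Nat.find h then digit β 1 (n % Nat.find h) - 1
    else digit β 1 (n % Nat.find h)
  else digit β 1 n

/-- Strict lexicographic order `x ≺ y`. -/
def LexLT (x y : ℕ → ℕ) : Prop :=
  ∃ n, (∀ i < n, x i = y i) ∧ x n < y n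

/-- The two-sided `β`-compactum: `(ε_n, ε_{n+1}, …) ≺ (d_1, d_2, …)` for all `n ∈ ℤ`. -/
def compactum (β : ℝ) : Set (ℤ → ℕ) :=
  {ε | ∀ n : ℤ, LexLT (fun i : ℕ => ε (n + i)) (quasiGreedy β)}

/-- `ε` is the `β`-expansion `x = ∑ ε_k β^{-k}` of the real `x ≥ 0`, written as a two-sided
sequence: the greedy expansion of `x β^{-N} ∈ [0,1)`, moved `N` places to the left. -/
def IsBetaExpansion (β x : ℝ) (ε : ℤ → ℕ) : Prop :=
  ∃ N : ℕ, 0 ≤ x ∧ x < β ^ N ∧ (∀ n : ℕ, ε (n + 1 - N) = digit β (x / β ^ N) n) ∧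
    ∀ k : ℤ, k ≤ -N → ε k = 0

/-! ### The symbolic Pisot group -/

/-- The map `g`: to a class `a ∈ 𝒜_β` it assigns the set of all purely periodic two-sided sequences
in the compactum that extend the tail of the `β`-expansion of some nonnegative `ξ ∈ a`. -/
def symbolicClass (β : ℝ) (a : PisotGroup β) : Set (compactum β) :=
  {ε | (∃ d : ℕ, 0 < d ∧ ∀ k : ℤ, ε.1 (k + d) = ε.1 k) ∧
    ∃ ξ : pisotP β, (QuotientAddGroup.mk ξ : PisotGroup β) = a ∧ 0 ≤ (ξ : ℝ) ∧
      ∃ δ : ℤ → ℕ, IsBetaExpansion β ξ δ ∧ ∃ K : ℤ, ∀ k ≥ K, ε.1 k = δ k}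

/-- The symbolic Pisot group `𝔄_β`, the image of `g`; its elements are classes of sequences. -/
def symbolicPisotGroup (β : ℝ) : Set (Set (compactum β)) :=
  Set.range (symbolicClass β)

/-! ### The toral automorphism and the codings -/

/-- The torus `𝕋^m = ℝ^m / ℤ^m`. -/
abbrev Torus (β : ℝ) : Type := Fin (deg β) → UnitAddCircle

/-- The companion matrix of `x^m - k_1 x^{m-1} - … - k_m`, the minimal polynomial of `β`: first row
`k_1, …, k_m`, ones below the diagonal. -/
noncomputable def companion (β : ℝ) : Matrix (Fin (deg β)) (Fin (deg β)) ℤ :=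
  Matrix.of fun i j =>
    if (i : ℕ) = 0 then -(minpoly ℤ β).coeff (deg β - 1 - j)
    else if (i : ℕ) = j + 1 then 1 else 0

/-- The action of an integer matrix on the torus. -/
def toralMap {m : ℕ} (A : Matrix (Fin m) (Fin m) ℤ) (x : Fin m → UnitAddCircle) :
    Fin m → UnitAddCircle :=
  fun i => ∑ j, A i j • x j

/-- The point `(ξ, ξβ⁻¹, …, ξβ^{-m+1})` of the torus. -/
noncomputable def linePoint (β ξ : ℝ) : Torus β :=
  fun i => ((ξ * (β ^ (i : ℕ))⁻¹ : ℝ) : UnitAddCircle)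

/-- The term `ε_k T^{-k} t` with `t = (ξ, ξβ⁻¹, …, ξβ^{-m+1})`, where `T` is the automorphism given
by the companion matrix. -/
noncomputable def codingTerm (β ξ : ℝ) (ε : compactum β) (k : ℤ) : Torus β :=
  ε.1 k • toralMap (companion β ^ (-k)) (linePoint β ξ)

/-- The coding `ε ↦ ∑_{k ∈ ℤ} ε_k T^{-k} t` with `t = (ξ, ξβ⁻¹, …, ξβ^{-m+1})`. -/
noncomputable def coding (β ξ : ℝ) (ε : compactum β) : Torus β :=
  ∑' k : ℤ, codingTerm β ξ ε k

/-- `ξ₀ = 1 / g'(β)`, where `g` is the minimal polynomial of `β`. -/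
noncomputable def xiZero (β : ℝ) : ℝ := (aeval β (derivative (minpoly ℤ β)))⁻¹

/-- The coding `φ₀`, with `t₀ = (ξ₀, ξ₀β⁻¹, …, ξ₀β^{-m+1})`. -/
noncomputable def phiZero (β : ℝ) (ε : compactum β) : Torus β := coding β (xiZero β) ε

/-- The coding `φ`, with `t = (1, β⁻¹, …, β^{-m+1})`. -/
noncomputable def phi (β : ℝ) (ε : compactum β) : Torus β := coding β 1 ε

/-- The relation `ε ∼ ε'` iff `φ₀(ε) = φ₀(ε')`. -/
noncomputable def codingSetoid (β : ℝ) : Setoid (compactum β) := Setoid.ker (phiZero β)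

/-- The quotient `X'_β = X_β / ∼`. -/
noncomputable def QuotientCompactum (β : ℝ) : Type := Quotient (codingSetoid β)

/-- The class `[ε]` in `X'_β`. -/
noncomputable def toQuotient (β : ℝ) (ε : compactum β) : QuotientCompactum β :=
  Quotient.mk (codingSetoid β) ε

/-- An element of `X'_β` as a set of sequences. -/
noncomputable def classSet (β : ℝ) (x : QuotientCompactum β) : Set (compactum β) :=
  {ε | toQuotient β ε = x}

end PisotCoding

open PisotCoding

namespace PisotCoding

variable {β : ℝ}

/-! ### The companion matrix over a commutative ring -/

/-! Write `M` for the companion matrix and `t₀` for `baseVec β`. The space `ℝ^m` splits into the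
eigenline of `M` for `β`, spanned by `t₀`, and a stable hyperplane on which `M` contracts, because
the other conjugates lie inside the unit disc. The hyperplane is the kernel of the functional
`unst`, which satisfies `unst ∘ M = β · unst` and `unst t₀ = 1` and maps `ℤ^m` bijectively onto
`ℤ[β]`.

The coding lifts to `ℝ^m`: for `k ≤ 0` the vector `t₀` is replaced by `t₀ - z` with `z` integral and
`unst z = 1`, which is stable, so the two-sided series `realCode` converges absolutely. Its `unst`
is the value of the digits with positive index. Surjectivity of `φ₀` follows from density of the
unstable line and compactness of the closure condition "all tails at most `d`"; the tails equal to
`d` that this admits are removed by a carry (`phiZero_surjective`).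

Since `g'(M) t₀ = (1, β⁻¹, …)`, one has `φ = g'(T) ∘ φ₀`. This gives well-definedness and
additivity, and the kernel corresponds to `ker g'(T)`. The lattice `g'(M)⁻¹ ℤ^m` is mapped by `unst`
isomorphically onto `g'(β)⁻¹ ℤ[β]`, which is `𝒫_β` (`mem_pisotP_iff`), so `ker g'(T) ≅ 𝒫_β / ℤ[β]`
through `pisotHom`.

It remains to identify the fibre of `φ₀` over `pisotHom ξ` with the symbolic class of `ξ`
(`mem_symbolicClass_iff`). If `φ₀(ε)` lies in `ker g'(T)`, the lifts of all shifts of `ε` are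
bounded points of one lattice, hence finitely many, and `ε` is periodic. Conversely, a common tail
with the expansion of `ξ` makes `φ₀(ε) - pisotHom ξ` contract under `T`; periodicity keeps it in a
finite set along multiples of the period, so it is zero. -/

lemma deg_pos (hβ : IsPisotUnit β) : 0 < deg β := minpoly.natDegree_pos hβ.isIntegral

lemma monic_minpoly (hβ : IsPisotUnit β) : (minpoly ℤ β).Monic := minpoly.monic hβ.isIntegral

/-- An integer matrix with its entries cast to the ring `R`. -/
noncomputable def castMat (R : Type*) [CommRing R] {m : ℕ} :
    Matrix (Fin m) (Fin m) ℤ →+* Matrix (Fin m) (Fin m) R :=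
  (Int.castRingHom R).mapMatrix

lemma companion_mulVec_succ {R : Type*} [CommRing R] (v : Fin (deg β) → R) (i : ℕ)
    (hi : i + 1 < deg β) :
    (castMat R (companion β)).mulVec v ⟨i + 1, hi⟩ = v ⟨i, by omega⟩ := by
  rw [Matrix.mulVec, dotProduct, Finset.sum_eq_single ⟨i, by omega⟩]
  · simp [castMat, companion]
  · intro j _ hj
    have : i ≠ (j : ℕ) := fun h => hj (Fin.ext h.symm)
    simp [castMat, companion, this]
  · simp

lemma companion_mulVec_zero {R : Type*} [CommRing R] (v : Fin (deg β) → R) (h0 : 0 < deg β) :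
    (castMat R (companion β)).mulVec v ⟨0, h0⟩ =
      -∑ j : Fin (deg β), (((minpoly ℤ β).coeff (deg β - 1 - j) : ℤ) : R) * v j := by
  simp [Matrix.mulVec, dotProduct, castMat, companion]

lemma companion_pow_mulVec_add {R : Type*} [CommRing R] (n : ℕ) : ∀ (v : Fin (deg β) → R) (i : ℕ)
    (hi : i + n < deg β),
    (castMat R (companion β) ^ n).mulVec v ⟨i + n, hi⟩ = v ⟨i, by omega⟩ := by
  induction n with
  | zero => intro v i hi; simp
  | succ n ih =>
    intro v i hi
    rw [pow_succ', ← Matrix.mulVec_mulVec]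
    exact (companion_mulVec_succ _ (i + n) hi).trans (ih v i (by omega))

/-- Below its first row the matrix only moves coordinates down, so the last coordinate of the
iterates reads off the entries of `v` one after another. Identities between vectors thus reduce to
last coordinates. -/
lemma companion_pow_mulVec_last {R : Type*} [CommRing R] (hd : 0 < deg β) (v : Fin (deg β) → R)
    (n : ℕ) (hn : n < deg β) :
    (castMat R (companion β) ^ n).mulVec v ⟨deg β - 1, by omega⟩ =
      v ⟨deg β - 1 - n, by omega⟩ := by
  have h := companion_pow_mulVec_add n v (deg β - 1 - n) (by omega)
  convert h using 3
  omega

/-- A vector is determined by the last coordinates of its iterates. -/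
lemma eq_zero_of_last {R : Type*} [CommRing R] (hd : 0 < deg β) (v : Fin (deg β) → R)
    (h : ∀ n, (castMat R (companion β) ^ n).mulVec v ⟨deg β - 1, by omega⟩ = 0) : v = 0 := by
  funext i
  have h1 := companion_pow_mulVec_last hd v (deg β - 1 - i) (by omega)
  rw [h] at h1
  rw [Pi.zero_apply, h1]
  congr 1
  ext
  simp
  omega

/-- The first row of the matrix makes the last coordinate of `g(M) v` vanish for every `v`. As
`g(M)` commutes with `M ^ n`, the same holds for all iterates, and these determine the vector. -/
lemma aeval_companion (hβ : IsPisotUnit β) (R : Type*) [CommRing R] :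
    aeval (castMat R (companion β)) (minpoly ℤ β) = 0 := by
  have hd := deg_pos hβ
  have key : ∀ v : Fin (deg β) → R,
      (aeval (castMat R (companion β)) (minpoly ℤ β)).mulVec v ⟨deg β - 1, by omega⟩ = 0 := by
    intro v
    rw [aeval_eq_sum_range, Matrix.sum_mulVec, Finset.sum_apply]
    change ∑ c ∈ Finset.range (deg β + 1), _ = _
    rw [Finset.sum_range_succ]
    have h1 : (minpoly ℤ β).coeff (deg β) = 1 := monic_minpoly hβ
    have h2 : (castMat R (companion β) ^ (deg β)).mulVec v ⟨deg β - 1, by omega⟩ =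
        (castMat R (companion β)).mulVec v ⟨0, hd⟩ := by
      have e : castMat R (companion β) ^ (deg β) =
          castMat R (companion β) ^ (deg β - 1) * castMat R (companion β) := by
        rw [← pow_succ]; congr 1; omega
      rw [e, ← Matrix.mulVec_mulVec, companion_pow_mulVec_last hd _ _ (by omega)]
      congr 1
      ext
      simp
    rw [h1, one_smul, h2, companion_mulVec_zero, add_neg_eq_zero, ← Finset.sum_range_reflect,
      ← Fin.sum_univ_eq_sum_range (fun j => ((minpoly ℤ β).coeff (deg β - 1 - j) •
        castMat R (companion β) ^ (deg β - 1 - j)).mulVec v ⟨deg β - 1, by omega⟩)]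
    refine Finset.sum_congr rfl fun j _ => ?_
    rw [Matrix.smul_mulVec, Pi.smul_apply, companion_pow_mulVec_last hd _ _ (by omega),
      zsmul_eq_mul]
    congr 2
    ext
    simp
    omega
  apply Matrix.toLin'.injective
  refine LinearMap.ext fun v => ?_
  rw [Matrix.toLin'_apply, map_zero, LinearMap.zero_apply]
  refine eq_zero_of_last hd _ fun n => ?_
  rw [Matrix.mulVec_mulVec]
  have hc : castMat R (companion β) ^ n * aeval (castMat R (companion β)) (minpoly ℤ β) =
      aeval (castMat R (companion β)) (minpoly ℤ β) * castMat R (companion β) ^ n := by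
    have h : castMat R (companion β) ^ n = aeval (castMat R (companion β)) (X ^ n : ℤ[X]) := by
      simp
    rw [h, ← map_mul, ← map_mul, mul_comm]
  rw [hc, ← Matrix.mulVec_mulVec]
  exact key _

lemma castMat_int {m : ℕ} (A : Matrix (Fin m) (Fin m) ℤ) : castMat ℤ A = A := by
  ext; simp [castMat]

/-- In `g(M) = 0` the constant term is `±1`; moving it to the other side exhibits `±1` as a multiple
of `M`. -/
lemma isUnit_companion (hβ : IsPisotUnit β) : IsUnit (companion β) := by
  have h := aeval_companion hβ ℤ
  rw [castMat_int] at h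
  rw [← divX_mul_X_add (minpoly ℤ β), map_add, map_mul, aeval_X, aeval_C] at h
  obtain ⟨u, hu⟩ := hβ.unit
  rw [← hu] at h
  have h2 : aeval (companion β) (minpoly ℤ β).divX * companion β =
      algebraMap ℤ (Matrix (Fin (deg β)) (Fin (deg β)) ℤ) (-u : ℤˣ) := by
    rw [Units.val_neg, map_neg]; exact eq_neg_of_add_eq_zero_left h
  have h3 : IsUnit (aeval (companion β) (minpoly ℤ β).divX * companion β) := by
    rw [h2]; exact ((-u).isUnit).map _
  rw [Matrix.isUnit_iff_isUnit_det, Matrix.det_mul] at h3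
  exact (Matrix.isUnit_iff_isUnit_det _).2 (isUnit_of_mul_isUnit_right h3)

lemma isUnit_det_companion (hβ : IsPisotUnit β) : IsUnit (companion β).det :=
  (Matrix.isUnit_iff_isUnit_det _).1 (isUnit_companion hβ)

/-! ### The action on real vectors -/

/-- The action of an integer matrix on `ℝ^m`. -/
noncomputable def act {m : ℕ} (A : Matrix (Fin m) (Fin m) ℤ) : (Fin m → ℝ) →ₗ[ℝ] (Fin m → ℝ) :=
  Matrix.toLin' (castMat ℝ A)

lemma act_apply {m : ℕ} (A : Matrix (Fin m) (Fin m) ℤ) (v : Fin m → ℝ) :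
    act A v = (castMat ℝ A).mulVec v := rfl

lemma act_mul {m : ℕ} (A B : Matrix (Fin m) (Fin m) ℤ) (v : Fin m → ℝ) :
    act (A * B) v = act A (act B v) := by
  simp [act_apply]

lemma act_one {m : ℕ} (v : Fin m → ℝ) : act (1 : Matrix (Fin m) (Fin m) ℤ) v = v := by
  simp [act_apply]

lemma act_zpow_add (hβ : IsPisotUnit β) (j k : ℤ) (v : Fin (deg β) → ℝ) :
    act (companion β ^ (j + k)) v = act (companion β ^ j) (act (companion β ^ k) v) := by
  rw [Matrix.zpow_add (isUnit_det_companion hβ), act_mul]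

/-- The vector `(1, β⁻¹, …, β^{-m+1})`. -/
noncomputable def lineVec (β : ℝ) : Fin (deg β) → ℝ := fun i => (β ^ (i : ℕ))⁻¹

lemma pos (hβ : IsPisotUnit β) : 0 < β := zero_lt_one.trans hβ.one_lt

lemma act_companion_lineVec (hβ : IsPisotUnit β) :
    act (companion β) (lineVec β) = β • lineVec β := by
  have hd := deg_pos hβ
  have h0 : β ≠ 0 := (pos hβ).ne'
  funext ⟨i, hi⟩
  rw [act_apply]
  cases i with
  | succ i =>
    rw [companion_mulVec_succ]
    simp only [lineVec, Pi.smul_apply, smul_eq_mul, pow_succ]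
    field_simp
  | zero =>
    rw [companion_mulVec_zero]
    have h := minpoly.aeval ℤ β
    rw [aeval_eq_sum_range] at h
    change ∑ c ∈ Finset.range (deg β + 1), _ = _ at h
    rw [Finset.sum_range_succ,
      show (minpoly ℤ β).coeff (deg β) = 1 from monic_minpoly hβ,
      one_smul, ← Finset.sum_range_reflect, ← Fin.sum_univ_eq_sum_range
        (fun j => (minpoly ℤ β).coeff (deg β - 1 - j) • β ^ (deg β - 1 - j))] at h
    have h1 : β ^ (deg β - 1) ≠ 0 := pow_ne_zero _ h0
    have h2 : ∀ j : Fin (deg β), (minpoly ℤ β).coeff (deg β - 1 - j) • β ^ (deg β - 1 - j) =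
        β ^ (deg β - 1) * ((((minpoly ℤ β).coeff (deg β - 1 - j) : ℤ) : ℝ) * lineVec β j) := by
      intro j
      have e : β ^ (deg β - 1) = β ^ (deg β - 1 - j) * β ^ (j : ℕ) := by
        rw [← pow_add]; congr 1; omega
      rw [e, lineVec, zsmul_eq_mul]
      field_simp
    rw [Finset.sum_congr rfl (fun j _ => h2 j), ← Finset.mul_sum] at h
    have h3 : β ^ deg β = β ^ (deg β - 1) * β := by rw [← pow_succ]; congr 1; omega
    rw [h3, ← mul_add] at h
    have h4 := (mul_eq_zero.1 h).resolve_left h1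
    simp only [Pi.smul_apply, smul_eq_mul, lineVec, pow_zero, inv_one, mul_one] at *
    linarith

lemma act_zpow_of_eigen (hβ : IsPisotUnit β) {v : Fin (deg β) → ℝ}
    (hv : act (companion β) v = β • v) (k : ℤ) : act (companion β ^ k) v = β ^ k • v := by
  have h0 : β ≠ 0 := (pos hβ).ne'
  have hn : ∀ n : ℕ, act (companion β ^ n) v = β ^ n • v := by
    intro n
    induction n with
    | zero => simp [act_one]
    | succ n ih => rw [pow_succ, act_mul, hv, map_smul, ih, smul_smul, pow_succ, mul_comm]
  obtain ⟨n, rfl | rfl⟩ := k.eq_nat_or_neg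
  · simpa using hn n
  · have h := act_zpow_add hβ (-(n : ℤ)) n v
    rw [neg_add_cancel, zpow_zero, act_one, zpow_natCast, hn, map_smul] at h
    rw [zpow_neg, zpow_natCast]
    conv_rhs => rw [h]
    rw [smul_smul, inv_mul_cancel₀ (pow_ne_zero _ h0), one_smul]

/-! ### The unstable functional -/

/-- The cofactor `g(x) / (x - β)`. -/
noncomputable def cofactor (β : ℝ) : ℝ[X] := (minpoly ℤ β).map (Int.castRingHom ℝ) /ₘ (X - C β)

lemma isRoot_minpoly (β : ℝ) : ((minpoly ℤ β).map (Int.castRingHom ℝ)).IsRoot β := by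
  have h := minpoly.aeval ℤ β
  rwa [aeval_def, ← eval_map] at h

lemma mul_cofactor (β : ℝ) :
    (X - C β) * cofactor β = (minpoly ℤ β).map (Int.castRingHom ℝ) :=
  mul_divByMonic_eq_iff_isRoot.2 (isRoot_minpoly β)

/-- The number `g'(β)`. -/
noncomputable def derivAt (β : ℝ) : ℝ := aeval β (derivative (minpoly ℤ β))

lemma eval_cofactor (β : ℝ) : (cofactor β).eval β = derivAt β := by
  have h := congrArg (fun p => (derivative p).eval β) (mul_cofactor β)
  simp only [derivative_mul, derivative_sub, derivative_X, derivative_C, derivative_map] at h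
  rw [derivAt, aeval_def, ← eval_map]
  simpa using h

lemma separable_minpoly (hβ : IsPisotUnit β) :
    ((minpoly ℤ β).map (Int.castRingHom ℝ)).Separable := by
  have h1 := minpoly.isIntegrallyClosed_eq_field_fractions' ℚ hβ.isIntegral
  have h2 : (minpoly ℚ β).Separable :=
    (minpoly.irreducible (hβ.isIntegral.tower_top (A := ℚ))).separable
  have h3 := h2.map (f := algebraMap ℚ ℝ)
  rw [h1, Polynomial.map_map] at h3
  rwa [RingHom.ext_int ((algebraMap ℚ ℝ).comp (algebraMap ℤ ℚ)) (Int.castRingHom ℝ)] at h3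

lemma derivAt_ne_zero (hβ : IsPisotUnit β) : derivAt β ≠ 0 := by
  have h := (separable_minpoly hβ).eval₂_derivative_ne_zero (RingHom.id ℝ) (x := β)
    (by simpa using isRoot_minpoly β)
  rw [derivAt, aeval_def, ← eval_map]
  simpa [derivative_map] using h

/-- The matrix `g(x) / (x - β)` evaluated at the companion matrix. -/
noncomputable def cofMat (β : ℝ) : Matrix (Fin (deg β)) (Fin (deg β)) ℝ :=
  aeval (castMat ℝ (companion β)) (cofactor β)

lemma companion_mul_cofMat (hβ : IsPisotUnit β) :
    castMat ℝ (companion β) * cofMat β = β • cofMat β := by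
  have h : aeval (castMat ℝ (companion β)) ((X - C β) * cofactor β) = 0 := by
    rw [mul_cofactor]
    exact (aeval_map_algebraMap ℝ _ (minpoly ℤ β)).trans (aeval_companion hβ ℝ)
  rw [map_mul, map_sub, aeval_X, aeval_C, sub_mul, sub_eq_zero] at h
  rw [cofMat, h, Algebra.algebraMap_eq_smul_one, smul_mul_assoc, one_mul]

lemma cofMat_mul_companion (hβ : IsPisotUnit β) :
    cofMat β * castMat ℝ (companion β) = β • cofMat β := by
  rw [← companion_mul_cofMat hβ]
  have h := congrArg (aeval (castMat ℝ (companion β))) (mul_comm (cofactor β) X)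
  rwa [map_mul, map_mul, aeval_X] at h

open Classical in
/-- The left eigenvector of the companion matrix for the eigenvalue `β`. -/
noncomputable def unst (β : ℝ) : (Fin (deg β) → ℝ) →ₗ[ℝ] ℝ :=
  if h : 0 < deg β then
    β ^ (deg β - 1) • (LinearMap.proj ⟨deg β - 1, by omega⟩).comp (Matrix.toLin' (cofMat β))
  else 0

lemma unst_apply (hd : 0 < deg β) (v : Fin (deg β) → ℝ) :
    unst β v = β ^ (deg β - 1) * (cofMat β).mulVec v ⟨deg β - 1, by omega⟩ := by
  simp [unst, hd]

lemma unst_companion (hβ : IsPisotUnit β) (v : Fin (deg β) → ℝ) :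
    unst β (act (companion β) v) = β * unst β v := by
  rw [unst_apply (deg_pos hβ), unst_apply (deg_pos hβ), act_apply, Matrix.mulVec_mulVec,
    cofMat_mul_companion hβ, Matrix.smul_mulVec, Pi.smul_apply, smul_eq_mul]
  ring

lemma unst_zpow (hβ : IsPisotUnit β) (k : ℤ) (v : Fin (deg β) → ℝ) :
    unst β (act (companion β ^ k) v) = β ^ k * unst β v := by
  have h0 : β ≠ 0 := (pos hβ).ne'
  have hn : ∀ (n : ℕ) v, unst β (act (companion β ^ n) v) = β ^ n * unst β v := by
    intro n
    induction n with
    | zero => simp [act_one]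
    | succ n ih => intro v; rw [pow_succ, act_mul, ih, unst_companion hβ, pow_succ, mul_assoc]
  obtain ⟨n, rfl | rfl⟩ := k.eq_nat_or_neg
  · simpa using hn n v
  · have h := hn n (act (companion β ^ (-(n : ℤ))) v)
    rw [← zpow_natCast (companion β), ← act_zpow_add hβ, add_neg_cancel, zpow_zero, act_one] at h
    rw [h, zpow_neg, zpow_natCast, inv_mul_cancel_left₀ (pow_ne_zero _ h0)]

/-- The vector `cofMat β v` satisfies `M w = β w`, so all its iterates have last coordinate zero as
soon as it has. Thus the single functional `unst` detects the whole matrix. -/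
lemma cofMat_mulVec_eq_zero (hβ : IsPisotUnit β) {v : Fin (deg β) → ℝ} (hv : unst β v = 0) :
    (cofMat β).mulVec v = 0 := by
  have hd := deg_pos hβ
  have h0 : β ≠ 0 := (pos hβ).ne'
  rw [unst_apply hd] at hv
  have h1 := (mul_eq_zero.1 hv).resolve_left (pow_ne_zero _ h0)
  refine eq_zero_of_last hd _ fun n => ?_
  have : castMat ℝ (companion β) ^ n * cofMat β = β ^ n • cofMat β := by
    induction n with
    | zero => simp
    | succ n ih => rw [pow_succ, mul_assoc, companion_mul_cofMat hβ, mul_smul_comm, ih, smul_smul,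
        pow_succ, mul_comm]
  rw [Matrix.mulVec_mulVec, this, Matrix.smul_mulVec, Pi.smul_apply, h1, smul_zero]

lemma aeval_mulVec_of_eigen {m : ℕ} (A : Matrix (Fin m) (Fin m) ℝ) (v : Fin m → ℝ) (b : ℝ)
    (h : A.mulVec v = b • v) (p : ℝ[X]) : (aeval A p).mulVec v = p.eval b • v := by
  induction p using Polynomial.induction_on' with
  | add p q hp hq => rw [map_add, Matrix.add_mulVec, hp, hq, eval_add, add_smul]
  | monomial n a =>
    have : (A ^ n).mulVec v = b ^ n • v := by
      induction n with
      | zero => simp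
      | succ n ih => rw [pow_succ, ← Matrix.mulVec_mulVec, h, Matrix.mulVec_smul, ih, smul_smul,
          pow_succ, mul_comm]
    rw [aeval_monomial, eval_monomial, Algebra.algebraMap_eq_smul_one, smul_mul_assoc, one_mul,
      Matrix.smul_mulVec, this, smul_smul]

/-- A polynomial in `M` acts on the eigenvector by its value at `β`, and the cofactor has the value
`g'(β)` there. The factor `β ^ (m - 1)` in `unst` cancels the last coordinate of `lineVec`. -/
lemma unst_lineVec (hβ : IsPisotUnit β) : unst β (lineVec β) = derivAt β := by
  have hd := deg_pos hβ
  have h0 : β ≠ 0 := (pos hβ).ne'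
  rw [unst_apply hd, cofMat, aeval_mulVec_of_eigen _ _ β (act_companion_lineVec hβ), eval_cofactor]
  have := pow_ne_zero (deg β - 1) h0
  simp only [Pi.smul_apply, lineVec, smul_eq_mul]
  field_simp

/-- The point `t₀ = (ξ₀, ξ₀β⁻¹, …, ξ₀β^{-m+1})` of `ℝ^m`. -/
noncomputable def baseVec (β : ℝ) : Fin (deg β) → ℝ := xiZero β • lineVec β

lemma unst_baseVec (hβ : IsPisotUnit β) : unst β (baseVec β) = 1 := by
  rw [baseVec, map_smul, unst_lineVec hβ]
  exact inv_mul_cancel₀ (derivAt_ne_zero hβ)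

lemma act_baseVec (hβ : IsPisotUnit β) (k : ℤ) :
    act (companion β ^ k) (baseVec β) = β ^ k • baseVec β := by
  rw [baseVec, map_smul, act_zpow_of_eigen hβ (act_companion_lineVec hβ), smul_comm]

/-! ### The integer lattice -/

/-- An integer vector as a real vector. -/
def intVec {m : ℕ} (z : Fin m → ℤ) : Fin m → ℝ := fun i => z i

lemma act_intVec {m : ℕ} (A : Matrix (Fin m) (Fin m) ℤ) (z : Fin m → ℤ) :
    act A (intVec z) = intVec (A.mulVec z) := by
  funext i
  simp [act_apply, castMat, intVec, Matrix.mulVec, dotProduct]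

lemma intVec_add {m : ℕ} (z w : Fin m → ℤ) : intVec (z + w) = intVec z + intVec w := by
  funext i; simp [intVec]

lemma intVec_sub {m : ℕ} (z w : Fin m → ℤ) : intVec (z - w) = intVec z - intVec w := by
  funext i; simp [intVec]

lemma mem_ringZ {x : ℝ} : x ∈ ringZ β ↔ x ∈ Algebra.adjoin ℤ ({β} : Set ℝ) := Iff.rfl

lemma self_mem_adjoin (β : ℝ) : β ∈ Algebra.adjoin ℤ ({β} : Set ℝ) :=
  Algebra.subset_adjoin rfl

lemma cofactor_coeff_mem (β : ℝ) (n : ℕ) :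
    (cofactor β).coeff n ∈ Algebra.adjoin ℤ ({β} : Set ℝ) := by
  rw [cofactor, coeff_divByMonic_X_sub_C]
  refine sum_mem fun i _ => mul_mem (pow_mem (self_mem_adjoin β) _) ?_
  rw [coeff_map]
  exact intCast_mem _ _

lemma unst_intVec_mem (hβ : IsPisotUnit β) (z : Fin (deg β) → ℤ) :
    unst β (intVec z) ∈ ringZ β := by
  rw [mem_ringZ, unst_apply (deg_pos hβ)]
  refine mul_mem (pow_mem (self_mem_adjoin β) _) ?_
  rw [cofMat, aeval_eq_sum_range, Matrix.sum_mulVec, Finset.sum_apply]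
  refine sum_mem fun i _ => ?_
  rw [Matrix.smul_mulVec, Pi.smul_apply, smul_eq_mul]
  refine mul_mem (cofactor_coeff_mem β i) ?_
  rw [← map_pow, ← act_apply, act_intVec]
  exact intCast_mem _ _

lemma natDegree_cofactor (hβ : IsPisotUnit β) : (cofactor β).natDegree = deg β - 1 := by
  rw [cofactor, natDegree_divByMonic _ (monic_X_sub_C β), natDegree_X_sub_C,
    (monic_minpoly hβ).natDegree_map]
  rfl

lemma monic_cofactor (hβ : IsPisotUnit β) : (cofactor β).Monic := by
  have h : ((X - C β) * cofactor β).Monic := by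
    rw [mul_cofactor]; exact (monic_minpoly hβ).map _
  exact (monic_X_sub_C β).of_mul_monic_left h

/-- The unstable functional takes the value `1` at an integer vector. -/
lemma exists_unst_eq_one (hβ : IsPisotUnit β) : ∃ z, unst β (intVec z) = 1 := by
  have hd := deg_pos hβ
  have h0 : β ≠ 0 := (pos hβ).ne'
  set e : Fin (deg β) → ℤ := Pi.single ⟨0, hd⟩ 1 with he
  -- Among the powers of `M` occurring in the cofactor, only the top one brings the first coordinate
  -- to the last place, and its coefficient is `1`.
  have h1 : unst β (intVec e) = β ^ (deg β - 1) := by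
    rw [unst_apply hd, cofMat, aeval_eq_sum_range, Matrix.sum_mulVec, Finset.sum_apply,
      natDegree_cofactor hβ, Finset.sum_eq_single (deg β - 1)]
    · have hc : (cofactor β).coeff (deg β - 1) = 1 := by
        rw [← natDegree_cofactor hβ, (monic_cofactor hβ).coeff_natDegree]
      rw [hc, one_smul, companion_pow_mulVec_last hd _ _ (by omega)]
      simp [intVec, he]
    · intro i hi hne
      have hi' : i < deg β := by have := Finset.mem_range.1 hi; omega
      rw [Matrix.smul_mulVec, Pi.smul_apply, companion_pow_mulVec_last hd _ _ hi']
      have : (⟨deg β - 1 - i, by omega⟩ : Fin (deg β)) ≠ ⟨0, hd⟩ := by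
        simp [Fin.ext_iff]; have := Finset.mem_range.1 hi; omega
      simp [intVec, he, this]
    · simp
  -- The inverse of `M` is integral, so dividing by `β ^ (m - 1)` stays within integer vectors.
  refine ⟨(companion β ^ (-((deg β - 1 : ℕ) : ℤ))).mulVec e, ?_⟩
  rw [← act_intVec, unst_zpow hβ, h1, zpow_neg, zpow_natCast, inv_mul_cancel₀ (pow_ne_zero _ h0)]

lemma exists_unst_eq (hβ : IsPisotUnit β) {x : ℝ} (hx : x ∈ ringZ β) :
    ∃ z, unst β (intVec z) = x := by
  rw [mem_ringZ, Algebra.adjoin_singleton_eq_range_aeval] at hx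
  obtain ⟨p, rfl⟩ := hx
  obtain ⟨z, hz⟩ := exists_unst_eq_one hβ
  change ∃ w, unst β (intVec w) = aeval β p
  induction p using Polynomial.induction_on' with
  | add p q hp hq =>
    obtain ⟨u, hu⟩ := hp
    obtain ⟨w, hw⟩ := hq
    exact ⟨u + w, by rw [intVec_add, map_add, hu, hw, map_add]⟩
  | monomial n a =>
    refine ⟨(companion β ^ (n : ℤ)).mulVec (a • z), ?_⟩
    have : intVec (a • z) = (a : ℝ) • intVec z := by funext i; simp [intVec]
    rw [← act_intVec, unst_zpow hβ, this, map_smul, hz, aeval_monomial]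
    simp [mul_comm]

/-! ### Contraction on the stable space -/

/-- Removing one root `α` at a time, `A ^ (n + 1) v` is `α A ^ n v` plus a term already bounded by
induction. The strict gap `‖α‖ < ρ` absorbs the polynomial factors that repeated roots would
produce. -/
lemma exists_bound_of_aeval_prod_eq_zero {m : ℕ} (A : Matrix (Fin m) (Fin m) ℂ) {ρ : ℝ}
    (hρ : 0 < ρ) (s : Multiset ℂ) (hs : ∀ α ∈ s, ‖α‖ < ρ) (v : Fin m → ℂ)
    (hv : (aeval A ((s.map fun α => X - C α).prod)).mulVec v = 0) :
    ∃ D : ℝ, ∀ n : ℕ, ‖(A ^ n).mulVec v‖ ≤ D * ρ ^ n := by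
  induction s using Multiset.induction generalizing v with
  | empty => exact ⟨0, fun n => by simp_all⟩
  | cons α s ih =>
    have hα : 0 < ρ - ‖α‖ := sub_pos.2 (hs α (Multiset.mem_cons_self α s))
    rw [Multiset.map_cons, Multiset.prod_cons, mul_comm, map_mul, ← Matrix.mulVec_mulVec] at hv
    obtain ⟨D, hD⟩ := ih (fun a ha => hs a (Multiset.mem_cons_of_mem ha)) _ hv
    have hD0 : 0 ≤ D := by simpa using (norm_nonneg _).trans (hD 0)
    refine ⟨‖v‖ + D / (ρ - ‖α‖), fun n => ?_⟩
    induction n with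
    | zero => simpa using div_nonneg hD0 hα.le
    | succ n ihn =>
      have e : (A ^ (n + 1)).mulVec v =
          (A ^ n).mulVec ((aeval A (X - C α)).mulVec v) + α • (A ^ n).mulVec v := by
        rw [pow_succ, ← Matrix.mulVec_mulVec, map_sub, aeval_X, aeval_C, Matrix.sub_mulVec,
          Matrix.mulVec_sub, Algebra.algebraMap_eq_smul_one, Matrix.smul_mulVec, Matrix.one_mulVec,
          Matrix.mulVec_smul, sub_add_cancel]
      rw [e]
      -- The summand `D / (ρ - ‖α‖)` is exactly what closes the recursion; `‖v‖` covers `n = 0`.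
      have h1 : D ≤ (ρ - ‖α‖) * (‖v‖ + D / (ρ - ‖α‖)) := by
        rw [mul_add, mul_div_cancel₀ _ hα.ne']
        have := mul_nonneg hα.le (norm_nonneg v)
        linarith
      calc _ ≤ ‖(A ^ n).mulVec ((aeval A (X - C α)).mulVec v)‖ + ‖α • (A ^ n).mulVec v‖ :=
            norm_add_le _ _
        _ ≤ D * ρ ^ n + ‖α‖ * ((‖v‖ + D / (ρ - ‖α‖)) * ρ ^ n) := by
            rw [norm_smul]
            gcongr
            exact hD n
        _ ≤ ((ρ - ‖α‖) * (‖v‖ + D / (ρ - ‖α‖))) * ρ ^ n +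
              ‖α‖ * ((‖v‖ + D / (ρ - ‖α‖)) * ρ ^ n) := by gcongr
        _ = (‖v‖ + D / (ρ - ‖α‖)) * ρ ^ (n + 1) := by ring

lemma exists_uniform_bound_lt_one (s : Multiset ℂ) (hs : ∀ α ∈ s, ‖α‖ < 1) :
    ∃ ρ : ℝ, 0 < ρ ∧ ρ < 1 ∧ ∀ α ∈ s, ‖α‖ < ρ := by
  induction s using Multiset.induction with
  | empty => exact ⟨1 / 2, by norm_num, by norm_num, by simp⟩
  | cons a s ih =>
    obtain ⟨ρ, h0, h1, h2⟩ := ih fun α h => hs α (Multiset.mem_cons_of_mem h)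
    obtain ⟨r, hr, hr1⟩ := exists_between (hs a (Multiset.mem_cons_self a s))
    refine ⟨max ρ r, lt_max_of_lt_left h0, max_lt h1 hr1, fun α h => ?_⟩
    rcases Multiset.mem_cons.1 h with rfl | h
    · exact lt_max_of_lt_right hr
    · exact lt_max_of_lt_left (h2 α h)

/-- A root of the cofactor is a root of `g`, and it is not `β` because `g'(β) ≠ 0`. -/
lemma norm_lt_one_of_mem_roots (hβ : IsPisotUnit β) {α : ℂ}
    (hα : α ∈ ((cofactor β).map Complex.ofRealHom).roots) : ‖α‖ < 1 := by
  have h1 : ((cofactor β).map Complex.ofRealHom).eval α = 0 := isRoot_of_mem_roots hα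
  apply hβ.conj_lt α
  · have h2 := congrArg (fun p => (p.map Complex.ofRealHom).eval α) (mul_cofactor β)
    simp only [Polynomial.map_mul, eval_mul, h1, mul_zero, Polynomial.map_map] at h2
    rw [aeval_def, ← eval_map, h2]
    congr 2
  · rintro rfl
    have h2 : ((cofactor β).map Complex.ofRealHom).eval (β : ℂ) = ((derivAt β : ℝ) : ℂ) := by
      rw [← eval_cofactor, eval_map]
      exact eval₂_at_apply Complex.ofRealHom β
    rw [h2] at h1
    exact derivAt_ne_zero hβ (by exact_mod_cast h1)

lemma ofReal_mulVec {m : ℕ} (A : Matrix (Fin m) (Fin m) ℝ) (v : Fin m → ℝ) :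
    (Complex.ofRealHom.mapMatrix A).mulVec (fun i => (v i : ℂ)) =
      fun i => ((A.mulVec v i : ℝ) : ℂ) := by
  funext i
  simp [Matrix.mulVec, dotProduct]

lemma norm_ofReal_comp {m : ℕ} (v : Fin m → ℝ) : ‖(fun i => (v i : ℂ))‖ = ‖v‖ := by
  simp [Pi.norm_def]

lemma exists_rate (hβ : IsPisotUnit β) : ∃ ρ : ℝ, 0 < ρ ∧ ρ < 1 ∧
    ∀ v, unst β v = 0 → ∃ D : ℝ, ∀ n : ℕ, ‖act (companion β ^ n) v‖ ≤ D * ρ ^ n := by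
  obtain ⟨ρ, h0, h1, h2⟩ := exists_uniform_bound_lt_one ((cofactor β).map Complex.ofRealHom).roots
    fun α hα => norm_lt_one_of_mem_roots hβ hα
  refine ⟨ρ, h0, h1, fun v hv => ?_⟩
  have hprod : ((((cofactor β).map Complex.ofRealHom).roots).map fun α => X - C α).prod =
      (cofactor β).map Complex.ofRealHom :=
    ((IsAlgClosed.splits _).eq_prod_roots_of_monic ((monic_cofactor hβ).map _)).symm
  obtain ⟨D, hD⟩ := exists_bound_of_aeval_prod_eq_zero
    (Complex.ofRealHom.mapMatrix (castMat ℝ (companion β))) h0 _ h2 (fun i => (v i : ℂ)) (by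
      rw [hprod, ← map_aeval_eq_aeval_map, ofReal_mulVec]
      · have := cofMat_mulVec_eq_zero hβ hv
        rw [cofMat] at this
        simp only [this]
        funext i
        simp
      · ext r i j
        by_cases hij : i = j <;> simp [Matrix.algebraMap_matrix_apply, hij])
  refine ⟨D, fun n => ?_⟩
  have h := hD n
  rwa [← map_pow, ofReal_mulVec, norm_ofReal_comp, ← map_pow] at h

/-- The projection to the stable space along the unstable line. -/
noncomputable def stab (β : ℝ) : (Fin (deg β) → ℝ) →ₗ[ℝ] (Fin (deg β) → ℝ) :=
  LinearMap.id - (unst β).smulRight (baseVec β)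

lemma stab_apply (v : Fin (deg β) → ℝ) : stab β v = v - unst β v • baseVec β := rfl

lemma unst_stab (hβ : IsPisotUnit β) (v : Fin (deg β) → ℝ) : unst β (stab β v) = 0 := by
  rw [stab_apply, map_sub, map_smul, unst_baseVec hβ, smul_eq_mul, mul_one, sub_self]

lemma exists_contraction (hβ : IsPisotUnit β) : ∃ ρ D : ℝ, 0 < ρ ∧ ρ < 1 ∧ 0 ≤ D ∧
    ∀ v (n : ℕ), ‖act (companion β ^ n) (stab β v)‖ ≤ D * ρ ^ n * ‖v‖ := by
  obtain ⟨ρ, h0, h1, h2⟩ := exists_rate hβ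
  choose D hD using fun i : Fin (deg β) => h2 (stab β (Pi.single i 1)) (unst_stab hβ _)
  have hD0 : ∀ i, 0 ≤ D i := fun i => by simpa using (norm_nonneg _).trans (hD i 0)
  refine ⟨ρ, ∑ i, D i, h0, h1, Finset.sum_nonneg fun i _ => hD0 i, fun v n => ?_⟩
  have e : v = ∑ i, v i • (Pi.single i 1 : Fin (deg β) → ℝ) := by
    funext j
    simp [Finset.sum_apply, Pi.single_apply]
  conv_lhs => rw [e]
  rw [map_sum, map_sum, Finset.sum_mul, Finset.sum_mul]
  refine (norm_sum_le _ _).trans (Finset.sum_le_sum fun i _ => ?_)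
  rw [map_smul, map_smul, norm_smul, mul_comm]
  gcongr
  · exact mul_nonneg (hD0 i) (by positivity)
  · exact hD i n
  · exact norm_le_pi_norm v i

lemma tendsto_act_of_unst_eq_zero (hβ : IsPisotUnit β) {v : Fin (deg β) → ℝ} (hv : unst β v = 0) :
    Tendsto (fun n : ℕ => act (companion β ^ n) v) atTop (𝓝 0) := by
  obtain ⟨ρ, h0, h1, h2⟩ := exists_rate hβ
  obtain ⟨D, hD⟩ := h2 v hv
  refine squeeze_zero_norm hD ?_
  simpa using (tendsto_pow_atTop_nhds_zero_of_lt_one h0.le h1).const_mul D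

lemma eq_zero_of_norm_intVec_lt_one {m : ℕ} {z : Fin m → ℤ} (h : ‖intVec z‖ < 1) : z = 0 := by
  funext i
  have h1 := (norm_le_pi_norm (intVec z) i).trans_lt h
  rw [intVec, Real.norm_eq_abs] at h1
  exact Int.abs_lt_one_iff.1 (by exact_mod_cast h1)

lemma companion_pow_mulVec_injective (hβ : IsPisotUnit β) (n : ℕ) {z : Fin (deg β) → ℤ}
    (hz : (companion β ^ n).mulVec z = 0) : z = 0 := by
  have h := congrArg (Matrix.mulVec ((companion β ^ n)⁻¹)) hz
  rwa [Matrix.mulVec_mulVec, Matrix.nonsing_inv_mul _ (by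
    rw [Matrix.det_pow]; exact (isUnit_det_companion hβ).pow n), Matrix.one_mulVec,
    Matrix.mulVec_zero] at h

/-- The orbit of a stable integer vector tends to zero through integer vectors, so it reaches zero,
and `M` is injective. -/
lemma eq_zero_of_unst_intVec (hβ : IsPisotUnit β) {z : Fin (deg β) → ℤ}
    (hz : unst β (intVec z) = 0) : z = 0 := by
  have h := (tendsto_act_of_unst_eq_zero hβ hz).norm
  rw [norm_zero] at h
  obtain ⟨n, hn⟩ := (h.eventually (gt_mem_nhds one_pos)).exists
  rw [act_intVec] at hn
  exact companion_pow_mulVec_injective hβ n (eq_zero_of_norm_intVec_lt_one hn)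

/-! ### The torus -/

/-- The projection `ℝ^m → 𝕋^m`. -/
def torusMk {m : ℕ} : (Fin m → ℝ) →+ (Fin m → UnitAddCircle) where
  toFun v := fun i => (v i : UnitAddCircle)
  map_zero' := by funext i; simp
  map_add' v w := by funext i; simp

lemma torusMk_apply {m : ℕ} (v : Fin m → ℝ) (i : Fin m) : torusMk v i = (v i : UnitAddCircle) := rfl

lemma continuous_torusMk {m : ℕ} :
    Continuous (torusMk : (Fin m → ℝ) → (Fin m → UnitAddCircle)) :=
  continuous_pi fun i => (AddCircle.continuous_mk' (1 : ℝ)).comp (continuous_apply i)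

lemma torusMk_surjective {m : ℕ} :
    Function.Surjective (torusMk : (Fin m → ℝ) → (Fin m → UnitAddCircle)) := by
  intro x
  choose v hv using fun i => QuotientAddGroup.mk_surjective (x i)
  exact ⟨v, funext hv⟩

lemma torusMk_eq_zero_iff {m : ℕ} {v : Fin m → ℝ} : torusMk v = 0 ↔ ∃ z, v = intVec z := by
  constructor
  · intro h
    choose z hz using fun i => (AddCircle.coe_eq_zero_iff (1 : ℝ)).1 (congrFun h i)
    exact ⟨z, funext fun i => by simpa [intVec] using (hz i).symm⟩
  · rintro ⟨z, rfl⟩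
    funext i
    exact (AddCircle.coe_eq_zero_iff (1 : ℝ)).2 ⟨z i, by simp [intVec]⟩

lemma torusMk_intVec {m : ℕ} (z : Fin m → ℤ) : torusMk (intVec z) = 0 :=
  torusMk_eq_zero_iff.2 ⟨z, rfl⟩

lemma toralMap_torusMk {m : ℕ} (A : Matrix (Fin m) (Fin m) ℤ) (v : Fin m → ℝ) :
    toralMap A (torusMk v) = torusMk (act A v) := by
  funext i
  have h := map_sum (QuotientAddGroup.mk' (AddSubgroup.zmultiples (1 : ℝ)))
    (fun j => (A i j : ℝ) * v j) Finset.univ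
  rw [torusMk_apply, act_apply]
  refine Eq.trans ?_ (h.symm.trans ?_)
  · refine Finset.sum_congr rfl fun j _ => ?_
    rw [torusMk_apply, ← AddCircle.coe_zsmul, zsmul_eq_mul]
    rfl
  · simp [castMat, Matrix.mulVec, dotProduct]

lemma toralMap_mul {m : ℕ} (A B : Matrix (Fin m) (Fin m) ℤ) (x : Fin m → UnitAddCircle) :
    toralMap (A * B) x = toralMap A (toralMap B x) := by
  obtain ⟨v, rfl⟩ := torusMk_surjective x
  simp only [toralMap_torusMk, act_mul]

lemma toralMap_one {m : ℕ} (x : Fin m → UnitAddCircle) :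
    toralMap (1 : Matrix (Fin m) (Fin m) ℤ) x = x := by
  obtain ⟨v, rfl⟩ := torusMk_surjective x
  rw [toralMap_torusMk, act_one]

/-- The action of an integer matrix on the torus, as a homomorphism. -/
def toralHom {m : ℕ} (A : Matrix (Fin m) (Fin m) ℤ) :
    (Fin m → UnitAddCircle) →+ (Fin m → UnitAddCircle) where
  toFun := toralMap A
  map_zero' := by funext i; simp [toralMap]
  map_add' x y := by funext i; simp [toralMap, Finset.sum_add_distrib]

lemma toralHom_apply {m : ℕ} (A : Matrix (Fin m) (Fin m) ℤ) (x : Fin m → UnitAddCircle) :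
    toralHom A x = toralMap A x := rfl

lemma continuous_toralHom {m : ℕ} (A : Matrix (Fin m) (Fin m) ℤ) : Continuous (toralHom A) :=
  continuous_pi fun i => continuous_finsetSum Finset.univ fun j _ =>
    (continuous_zsmul (A i j)).comp (continuous_apply j)

lemma toralMap_zpow_add (hβ : IsPisotUnit β) (j k : ℤ) (x : Torus β) :
    toralMap (companion β ^ (j + k)) x =
      toralMap (companion β ^ j) (toralMap (companion β ^ k) x) := by
  rw [Matrix.zpow_add (isUnit_det_companion hβ), toralMap_mul]

lemma toralMap_zpow_injective (hβ : IsPisotUnit β) (k : ℤ) :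
    Function.Injective (toralMap (companion β ^ k)) := by
  refine Function.LeftInverse.injective (g := toralMap (companion β ^ (-k))) fun x => ?_
  rw [← toralMap_zpow_add hβ, neg_add_cancel, zpow_zero, toralMap_one]

lemma linePoint_eq (β ξ : ℝ) : linePoint β ξ = torusMk (ξ • lineVec β) := rfl

lemma toralMap_linePoint (hβ : IsPisotUnit β) (k : ℤ) :
    toralMap (companion β ^ k) (linePoint β (xiZero β)) = torusMk (β ^ k • baseVec β) := by
  rw [linePoint_eq, toralMap_torusMk, ← act_baseVec hβ]
  rfl

/-! ### The real lift of the coding -/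

open Classical in
/-- A lift of `T^{-k} t₀` to `ℝ^m`, small at both ends. -/
noncomputable def liftTerm (β : ℝ) (k : ℤ) : Fin (deg β) → ℝ :=
  if h : ∃ z, unst β (intVec z) = 1 then
    if 0 < k then β ^ (-k) • baseVec β
    else act (companion β ^ (-k)) (baseVec β - intVec h.choose)
  else 0

lemma liftTerm_of_pos (hβ : IsPisotUnit β) {k : ℤ} (hk : 0 < k) :
    liftTerm β k = β ^ (-k) • baseVec β := by
  rw [liftTerm, dif_pos (exists_unst_eq_one hβ), if_pos hk]

lemma liftTerm_of_nonpos (hβ : IsPisotUnit β) : ∃ z, unst β (baseVec β - intVec z) = 0 ∧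
    ∀ k ≤ 0, liftTerm β k = act (companion β ^ (-k)) (baseVec β - intVec z) := by
  refine ⟨(exists_unst_eq_one hβ).choose, ?_, fun k hk => ?_⟩
  · rw [map_sub, unst_baseVec hβ, (exists_unst_eq_one hβ).choose_spec, sub_self]
  · rw [liftTerm, dif_pos (exists_unst_eq_one hβ), if_neg (not_lt.2 hk)]

lemma unst_liftTerm_of_pos (hβ : IsPisotUnit β) {k : ℤ} (hk : 0 < k) :
    unst β (liftTerm β k) = β ^ (-k) := by
  rw [liftTerm_of_pos hβ hk, map_smul, unst_baseVec hβ, smul_eq_mul, mul_one]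

lemma unst_liftTerm_of_nonpos (hβ : IsPisotUnit β) {k : ℤ} (hk : k ≤ 0) :
    unst β (liftTerm β k) = 0 := by
  obtain ⟨z, h0, h⟩ := liftTerm_of_nonpos hβ
  rw [h k hk, unst_zpow hβ, h0, mul_zero]

lemma torusMk_liftTerm (hβ : IsPisotUnit β) (k : ℤ) :
    torusMk (liftTerm β k) = toralMap (companion β ^ (-k)) (linePoint β (xiZero β)) := by
  rw [toralMap_linePoint hβ]
  rcases lt_or_ge 0 k with hk | hk
  · rw [liftTerm_of_pos hβ hk]
  · obtain ⟨z, -, h⟩ := liftTerm_of_nonpos hβ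
    rw [h k hk, map_sub, act_intVec, act_baseVec hβ, map_sub, torusMk_intVec, sub_zero]

/-- On the right the terms shrink like `β⁻ᵏ` along the eigenline; on the left they are forward
iterates of the stable vector `t₀ - z`. -/
lemma summable_norm_liftTerm (hβ : IsPisotUnit β) : Summable fun k => ‖liftTerm β k‖ := by
  apply Summable.of_nat_of_neg
  · rw [← summable_nat_add_iff 1]
    have hb : Summable fun n : ℕ => (β⁻¹) ^ (n + 1) * ‖baseVec β‖ :=
      ((summable_nat_add_iff 1).2 (summable_geometric_of_lt_one (inv_nonneg.2 (pos hβ).le)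
        (inv_lt_one_of_one_lt₀ hβ.one_lt))).mul_right _
    refine hb.congr fun n => ?_
    rw [liftTerm_of_pos hβ (by positivity), norm_smul, zpow_neg, zpow_natCast, ← inv_pow,
      Real.norm_of_nonneg (pow_nonneg (inv_nonneg.2 (pos hβ).le) _)]
  · obtain ⟨z, h0, h⟩ := liftTerm_of_nonpos hβ
    obtain ⟨ρ, hρ, hρ1, hr⟩ := exists_rate hβ
    obtain ⟨D, hD⟩ := hr _ h0
    refine Summable.of_nonneg_of_le (fun _ => norm_nonneg _) (fun n => ?_)
      ((summable_geometric_of_lt_one hρ.le hρ1).mul_left D)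
    rw [h _ (by simp), neg_neg, zpow_natCast]
    exact hD n

/-- The lift `∑ ε_k τ_k` of `∑ ε_k T^{-k} t₀` to `ℝ^m`. -/
noncomputable def realCode (β : ℝ) (ε : ℤ → ℕ) : Fin (deg β) → ℝ :=
  ∑' k, (ε k : ℝ) • liftTerm β k

lemma norm_smul_liftTerm_le {ε : ℤ → ℕ} {c : ℕ} (hc : ∀ k, ε k ≤ c) (k : ℤ) :
    ‖(ε k : ℝ) • liftTerm β k‖ ≤ c * ‖liftTerm β k‖ := by
  rw [norm_smul, Real.norm_natCast]
  have := hc k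
  gcongr

lemma summable_realCode (hβ : IsPisotUnit β) {ε : ℤ → ℕ} {c : ℕ} (hc : ∀ k, ε k ≤ c) :
    Summable fun k => (ε k : ℝ) • liftTerm β k :=
  Summable.of_norm_bounded ((summable_norm_liftTerm hβ).mul_left (c : ℝ)) (norm_smul_liftTerm_le hc)

lemma norm_realCode_le (hβ : IsPisotUnit β) {ε : ℤ → ℕ} {c : ℕ} (hc : ∀ k, ε k ≤ c) :
    ‖realCode β ε‖ ≤ ∑' k, c * ‖liftTerm β k‖ :=
  tsum_of_norm_bounded ((summable_norm_liftTerm hβ).mul_left (c : ℝ)).hasSum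
    (norm_smul_liftTerm_le hc)

lemma continuousOn_realCode (hβ : IsPisotUnit β) (c : ℕ) :
    ContinuousOn (realCode β) {ε | ∀ k, ε k ≤ c} := by
  refine continuousOn_tsum (u := fun k => c * ‖liftTerm β k‖) (fun k => ?_)
    ((summable_norm_liftTerm hβ).mul_left (c : ℝ)) fun k ε hε => norm_smul_liftTerm_le hε k
  exact (((continuous_of_discreteTopology (f := fun n : ℕ => (n : ℝ))).comp
    (continuous_apply k)).smul continuous_const).continuousOn

lemma hasSum_torus (hβ : IsPisotUnit β) {ε : ℤ → ℕ} {c : ℕ} (hc : ∀ k, ε k ≤ c) :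
    HasSum (fun k => ε k • toralMap (companion β ^ (-k)) (linePoint β (xiZero β)))
      (torusMk (realCode β ε)) := by
  have h := (summable_realCode hβ hc).hasSum.map torusMk continuous_torusMk
  rw [realCode]
  convert h using 2 with k
  rw [Function.comp, Nat.cast_smul_eq_nsmul, map_nsmul, torusMk_liftTerm hβ]

/-- The lift is cut at the index `0`, so shifting changes it by more than a power of `M`; the
relation holds only modulo `ℤ^m`, where it is a reindexing of the series. -/
lemma torusMk_realCode_shift (hβ : IsPisotUnit β) {ε : ℤ → ℕ} {c : ℕ} (hc : ∀ k, ε k ≤ c)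
    (j : ℤ) : torusMk (realCode β fun k => ε (k + j)) =
      toralMap (companion β ^ j) (torusMk (realCode β ε)) := by
  have h1 := (hasSum_torus hβ hc).map (toralHom (companion β ^ j)) (continuous_toralHom _)
  rw [← (Equiv.addRight j).hasSum_iff] at h1
  refine (hasSum_torus hβ (ε := fun k => ε (k + j)) fun k => hc _).unique ?_
  rw [← toralHom_apply]
  convert h1 using 2 with k
  simp only [Function.comp, Equiv.coe_addRight, map_nsmul, toralHom_apply]
  rw [← toralMap_zpow_add hβ]
  congr 3
  ring

/-- The value `∑ s_i β^{-i-1}` of a one-sided sequence. -/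
noncomputable def val (β : ℝ) (s : ℕ → ℕ) : ℝ := ∑' i, (s i : ℝ) * (β ^ (i + 1))⁻¹

lemma summable_val (hβ : 1 < β) {s : ℕ → ℕ} {c : ℕ} (hc : ∀ i, s i ≤ c) :
    Summable fun i => (s i : ℝ) * (β ^ (i + 1))⁻¹ := by
  have h0 : 0 < β := one_pos.trans hβ
  have hb : Summable fun n : ℕ => (c : ℝ) * (β⁻¹) ^ (n + 1) :=
    ((summable_nat_add_iff 1).2 (summable_geometric_of_lt_one (inv_nonneg.2 h0.le)
      (inv_lt_one_of_one_lt₀ hβ))).mul_left _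
  refine Summable.of_nonneg_of_le (fun i => by positivity) (fun i => ?_) hb
  rw [inv_pow]
  have := hc i
  gcongr

lemma tsum_int_of_nonpos {E : Type*} [AddCommGroup E] [TopologicalSpace E] [T2Space E]
    {f : ℤ → E} (hf : ∀ k ≤ 0, f k = 0) : ∑' k, f k = ∑' i : ℕ, f (1 + i) := by
  have hinj : Function.Injective fun i : ℕ => (1 + i : ℤ) := fun a b h => by simpa using h
  refine (hinj.tsum_eq fun k hk => ?_).symm
  by_contra hr
  refine hk (hf k ?_)
  by_contra hk'
  exact hr ⟨(k - 1).toNat, by simp; omega⟩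

lemma zpow_neg_one_add (β : ℝ) (i : ℕ) : β ^ (-(1 + i : ℤ)) = (β ^ (i + 1))⁻¹ := by
  rw [zpow_neg, show (1 + i : ℤ) = ((i + 1 : ℕ) : ℤ) by push_cast; ring, zpow_natCast]

lemma unst_realCode (hβ : IsPisotUnit β) {ε : ℤ → ℕ} {c : ℕ} (hc : ∀ k, ε k ≤ c) :
    unst β (realCode β ε) = val β fun i => ε (1 + i) := by
  have h := (LinearMap.toContinuousLinearMap (unst β)).map_tsum (summable_realCode hβ hc)
  rw [LinearMap.coe_toContinuousLinearMap'] at h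
  rw [realCode, h, tsum_int_of_nonpos, val]
  · refine tsum_congr fun i => ?_
    rw [map_smul, unst_liftTerm_of_pos hβ (by positivity), zpow_neg_one_add, smul_eq_mul]
  · intro k hk
    rw [map_smul, unst_liftTerm_of_nonpos hβ hk, smul_zero]

lemma realCode_of_nonpos (hβ : IsPisotUnit β) {ε : ℤ → ℕ} {c : ℕ} (hc : ∀ k, ε k ≤ c)
    (h0 : ∀ k ≤ 0, ε k = 0) : realCode β ε = (val β fun i => ε (1 + i)) • baseVec β := by
  rw [realCode, tsum_int_of_nonpos fun k hk => by simp [h0 k hk], val,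
    ← (summable_val hβ.one_lt fun i => hc (1 + i)).tsum_smul_const]
  refine tsum_congr fun i => ?_
  rw [liftTerm_of_pos hβ (by positivity), zpow_neg_one_add, smul_smul]

/-! ### The coding `φ` in terms of `φ₀` -/

/-- The integer matrix `g'(T)`. -/
noncomputable def derivMat (β : ℝ) : Matrix (Fin (deg β)) (Fin (deg β)) ℤ :=
  aeval (companion β) (derivative (minpoly ℤ β))

lemma act_aeval {m : ℕ} (A : Matrix (Fin m) (Fin m) ℤ) (p : ℤ[X]) (v : Fin m → ℝ) :
    act (aeval A p) v = ∑ i ∈ Finset.range (p.natDegree + 1), p.coeff i • act (A ^ i) v := by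
  have h : ∀ q : ℤ[X], aeval A q = ∑ i ∈ Finset.range (q.natDegree + 1), q.coeff i • A ^ i :=
    fun q => aeval_eq_sum_range A
  rw [h, act, map_sum, map_sum, LinearMap.sum_apply]
  refine Finset.sum_congr rfl fun i _ => ?_
  rw [map_zsmul, map_zsmul, LinearMap.smul_apply]
  rfl

lemma unst_derivMat (hβ : IsPisotUnit β) (v : Fin (deg β) → ℝ) :
    unst β (act (derivMat β) v) = derivAt β * unst β v := by
  rw [derivMat, act_aeval, map_sum, derivAt, aeval_eq_sum_range, Finset.sum_mul]
  refine Finset.sum_congr rfl fun i _ => ?_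
  rw [map_zsmul, ← zpow_natCast (companion β), unst_zpow hβ, zpow_natCast, smul_mul_assoc]

/-- On the eigenline `g'(M)` is multiplication by `g'(β)`, which clears the denominator of `ξ₀`.
This is the relation between the two codings. -/
lemma act_derivMat_baseVec (hβ : IsPisotUnit β) : act (derivMat β) (baseVec β) = lineVec β := by
  have h : act (derivMat β) (baseVec β) = derivAt β • baseVec β := by
    rw [derivMat, act_aeval, derivAt, aeval_eq_sum_range, Finset.sum_smul]
    refine Finset.sum_congr rfl fun i _ => ?_
    rw [← zpow_natCast (companion β), act_baseVec hβ, zpow_natCast, smul_assoc]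
  rw [h, baseVec, smul_smul]
  have : derivAt β * xiZero β = 1 := mul_inv_cancel₀ (derivAt_ne_zero hβ)
  rw [this, one_smul]

lemma codingTerm_one (hβ : IsPisotUnit β) (ε : compactum β) (k : ℤ) :
    codingTerm β 1 ε k = toralHom (derivMat β) (codingTerm β (xiZero β) ε k) := by
  rw [codingTerm, codingTerm, map_nsmul, toralMap_linePoint hβ, toralHom_apply, toralMap_torusMk,
    map_smul, act_derivMat_baseVec hβ, linePoint_eq, one_smul, toralMap_torusMk,
    act_zpow_of_eigen hβ (act_companion_lineVec hβ)]

lemma compactum_le (ε : compactum β) (k : ℤ) : ε.1 k ≤ quasiGreedy β 0 := by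
  obtain ⟨n, h1, h2⟩ := ε.2 k
  cases n with
  | zero => simpa using h2.le
  | succ n => simpa using (h1 0 n.succ_pos).le

lemma hasSum_phiZero (hβ : IsPisotUnit β) (ε : compactum β) :
    HasSum (codingTerm β (xiZero β) ε) (torusMk (realCode β ε.1)) :=
  hasSum_torus hβ (compactum_le ε)

lemma phiZero_eq (hβ : IsPisotUnit β) (ε : compactum β) :
    phiZero β ε = torusMk (realCode β ε.1) := (hasSum_phiZero hβ ε).tsum_eq

lemma hasSum_phi (hβ : IsPisotUnit β) (ε : compactum β) :
    HasSum (codingTerm β 1 ε) (toralHom (derivMat β) (phiZero β ε)) := by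
  rw [phiZero_eq hβ, funext (codingTerm_one hβ ε)]
  exact (hasSum_phiZero hβ ε).map (toralHom (derivMat β)) (continuous_toralHom _)

lemma phi_eq (hβ : IsPisotUnit β) (ε : compactum β) :
    phi β ε = toralHom (derivMat β) (phiZero β ε) := (hasSum_phi hβ ε).tsum_eq

/-! ### The group `𝒫_β` -/

lemma mem_pisotP {ξ : ℝ} : ξ ∈ pisotP β ↔
    Tendsto (fun n : ℕ => ‖((ξ * β ^ n : ℝ) : UnitAddCircle)‖) atTop (𝓝 0) := Iff.rfl

lemma act_companion_smul_lineVec (hβ : IsPisotUnit β) (x : ℝ) :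
    act (companion β) (x • lineVec β) = (x * β) • lineVec β := by
  rw [map_smul, act_companion_lineVec hβ, smul_smul]

lemma continuous_act {m : ℕ} (A : Matrix (Fin m) (Fin m) ℤ) : Continuous (act A) :=
  LinearMap.continuous_of_finiteDimensional _

lemma continuous_unst (β : ℝ) : Continuous (unst β) :=
  LinearMap.continuous_of_finiteDimensional _

/-- If `ξ ∈ 𝒫_β`, then `ξ βⁿ (1, β⁻¹, …)` is close to the forward orbit of an integer vector. -/
lemma exists_int_orbit (hβ : IsPisotUnit β) {ξ : ℝ} (hξ : ξ ∈ pisotP β) :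
    ∃ (z : Fin (deg β) → ℤ) (N : ℕ), Tendsto (fun k : ℕ => (ξ * β ^ (N + k)) • lineVec β -
      intVec ((companion β ^ k).mulVec z)) atTop (𝓝 0) := by
  have h0 : β ≠ 0 := (pos hβ).ne'
  set z : ℕ → Fin (deg β) → ℤ := fun n i => round (ξ * β ^ n * (β ^ (i : ℕ))⁻¹) with hz
  set r : ℕ → Fin (deg β) → ℝ := fun n => (ξ * β ^ n) • lineVec β - intVec (z n) with hr
  have hr0 : Tendsto r atTop (𝓝 0) := by
    refine tendsto_pi_nhds.2 fun i => ?_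
    rw [Pi.zero_apply, ← tendsto_add_atTop_iff_nat (i : ℕ)]
    refine squeeze_zero_norm (fun n => le_of_eq ?_) (mem_pisotP.1 hξ)
    rw [UnitAddCircle.norm_eq, Real.norm_eq_abs]
    -- Coordinate `i` at time `n + i` is again `ξ βⁿ`, so every coordinate has the same rounding
    -- errors, delayed.
    have e : ξ * β ^ (n + (i : ℕ)) * (β ^ (i : ℕ))⁻¹ = ξ * β ^ n := by
      rw [pow_add]; field_simp
    simp only [hr, hz, intVec, lineVec, Pi.sub_apply, Pi.smul_apply, smul_eq_mul, e]
  have hd : ∀ n, intVec (z (n + 1) - (companion β).mulVec (z n)) =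
      act (companion β) (r n) - r (n + 1) := by
    intro n
    rw [intVec_sub, ← act_intVec]
    simp only [hr]
    rw [map_sub, act_companion_smul_lineVec hβ, pow_succ, mul_assoc]
    abel
  have ht : Tendsto (fun n => ‖intVec (z (n + 1) - (companion β).mulVec (z n))‖) atTop (𝓝 0) := by
    simp only [hd]
    have h1 := ((continuous_act (companion β)).tendsto 0).comp hr0
    have h2 := (h1.sub ((tendsto_add_atTop_iff_nat 1).2 hr0)).norm
    simpa using h2
  -- Integer vectors of norm below `1` vanish, so from `N` on the nearest integer vectors form an
  -- exact orbit of `M`.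
  obtain ⟨N, hN⟩ := eventually_atTop.1 (ht.eventually (gt_mem_nhds one_pos))
  have hzk : ∀ k, z (N + k) = (companion β ^ k).mulVec (z N) := by
    intro k
    induction k with
    | zero => simp
    | succ k ih =>
      have := eq_zero_of_norm_intVec_lt_one (hN (N + k) (by omega))
      rw [sub_eq_zero] at this
      rw [← add_assoc, this, ih, pow_succ', Matrix.mulVec_mulVec]
  refine ⟨z N, N, ?_⟩
  simp only [← hzk]
  have h := (tendsto_add_atTop_iff_nat N).2 hr0
  simpa only [add_comm _ N] using h

/-- Both conditions say that some integer vector differs from a point of the unstable line, up to a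
power of `M`, by a stable vector. Forwards, the integer orbit shadowing `ξ βⁿ` must have the same
unstable component, since any discrepancy would grow like `βᵏ`; backwards, the stable difference
contracts. -/
lemma mem_pisotP_iff (hβ : IsPisotUnit β) {ξ : ℝ} :
    ξ ∈ pisotP β ↔ derivAt β * ξ ∈ ringZ β := by
  have h0 : β ≠ 0 := (pos hβ).ne'
  constructor
  · intro hξ
    obtain ⟨z, N, h⟩ := exists_int_orbit hβ hξ
    have h1 := ((continuous_unst β).tendsto 0).comp h
    have e : ∀ k : ℕ, unst β ((ξ * β ^ (N + k)) • lineVec β -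
        intVec ((companion β ^ k).mulVec z)) =
        β ^ k * (derivAt β * ξ * β ^ N - unst β (intVec z)) := by
      intro k
      rw [map_sub, map_smul, unst_lineVec hβ, ← act_intVec, ← zpow_natCast (companion β),
        unst_zpow hβ, zpow_natCast, smul_eq_mul, pow_add]
      ring
    simp only [Function.comp_def, e, map_zero] at h1
    have h2 : derivAt β * ξ * β ^ N - unst β (intVec z) = 0 := by
      rw [← abs_nonpos_iff]
      have h2 := h1.abs
      rw [abs_zero] at h2
      refine ge_of_tendsto' h2 fun k => ?_
      rw [abs_mul, abs_of_pos (pow_pos (pos hβ) k)]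
      exact le_mul_of_one_le_left (abs_nonneg _) (one_le_pow₀ hβ.one_lt.le)
    have h3 : derivAt β * ξ =
        unst β (intVec ((companion β ^ (-(N : ℤ))).mulVec z)) := by
      rw [← act_intVec, unst_zpow hβ, zpow_neg, zpow_natCast, ← sub_eq_zero.1 h2]
      field_simp
    rw [h3]
    exact unst_intVec_mem hβ _
  · intro hξ
    obtain ⟨z, hz⟩ := exists_unst_eq hβ hξ
    have h1 : unst β (ξ • lineVec β - intVec z) = 0 := by
      rw [map_sub, map_smul, unst_lineVec hβ, hz, smul_eq_mul, mul_comm, sub_self]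
    have h2 := (continuous_torusMk.tendsto 0).comp (tendsto_act_of_unst_eq_zero hβ h1)
    rw [map_zero] at h2
    have h3 := (tendsto_pi_nhds.1 h2 ⟨0, deg_pos hβ⟩).norm
    rw [Pi.zero_apply, norm_zero] at h3
    refine mem_pisotP.2 (h3.congr fun n => ?_)
    rw [Function.comp, map_sub, act_intVec, map_sub, torusMk_intVec, sub_zero, map_smul,
      ← zpow_natCast, act_zpow_of_eigen hβ (act_companion_lineVec hβ), torusMk_apply]
    simp [lineVec]

/-! ### The lattice over the kernel of `g'(T)` -/

/-- A Bézout identity `a g + b g' = 1`, evaluated at `M`, shows that `b(M)` inverts `g'(M)`. -/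
lemma exists_inverse_derivMat (hβ : IsPisotUnit β) :
    ∃ N : (Fin (deg β) → ℝ) →ₗ[ℝ] (Fin (deg β) → ℝ),
      (∀ v, act (derivMat β) (N v) = v) ∧ ∀ v, N (act (derivMat β) v) = v := by
  obtain ⟨a, b, hab⟩ := separable_minpoly hβ
  set A := castMat ℝ (companion β)
  have h1 : castMat ℝ (derivMat β) =
      aeval A (derivative ((minpoly ℤ β).map (Int.castRingHom ℝ))) := by
    rw [derivMat, derivative_map]
    exact map_aeval_eq_aeval_map (RingHom.ext_int _ _) _ _
  have h2 : aeval A ((minpoly ℤ β).map (Int.castRingHom ℝ)) = 0 :=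
    (aeval_map_algebraMap ℝ _ (minpoly ℤ β)).trans (aeval_companion hβ ℝ)
  have h3 : aeval A b * castMat ℝ (derivMat β) = 1 := by
    have := congrArg (aeval A) hab
    rwa [map_add, map_mul, map_mul, h2, mul_zero, zero_add, map_one, ← h1] at this
  have h4 : castMat ℝ (derivMat β) * aeval A b = 1 := mul_eq_one_comm.1 h3
  refine ⟨Matrix.toLin' (aeval A b), fun v => ?_, fun v => ?_⟩
  · rw [act_apply, Matrix.toLin'_apply, Matrix.mulVec_mulVec, h4, Matrix.one_mulVec]
  · rw [act_apply, Matrix.toLin'_apply, Matrix.mulVec_mulVec, h3, Matrix.one_mulVec]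

/-- The preimage in `ℝ^m` of the kernel of `g'(T)` on the torus. -/
noncomputable def kerLattice (β : ℝ) : AddSubgroup (Fin (deg β) → ℝ) :=
  ((toralHom (derivMat β)).comp torusMk).ker

lemma mem_kerLattice_iff {u : Fin (deg β) → ℝ} :
    u ∈ kerLattice β ↔ ∃ z, act (derivMat β) u = intVec z := by
  rw [← torusMk_eq_zero_iff, ← toralMap_torusMk]
  rfl

lemma intVec_mem_kerLattice (z : Fin (deg β) → ℤ) : intVec z ∈ kerLattice β :=
  mem_kerLattice_iff.2 ⟨_, act_intVec _ z⟩

lemma unst_mem_pisotP (hβ : IsPisotUnit β) {u : Fin (deg β) → ℝ} (hu : u ∈ kerLattice β) :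
    unst β u ∈ pisotP β := by
  obtain ⟨z, hz⟩ := mem_kerLattice_iff.1 hu
  rw [mem_pisotP_iff hβ, ← unst_derivMat hβ, hz]
  exact unst_intVec_mem hβ z

lemma exists_mem_kerLattice (hβ : IsPisotUnit β) {ξ : ℝ} (hξ : ξ ∈ pisotP β) :
    ∃ u ∈ kerLattice β, unst β u = ξ := by
  obtain ⟨z, hz⟩ := exists_unst_eq hβ ((mem_pisotP_iff hβ).1 hξ)
  obtain ⟨N, hN, -⟩ := exists_inverse_derivMat hβ
  refine ⟨N (intVec z), mem_kerLattice_iff.2 ⟨z, hN _⟩, ?_⟩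
  have h := unst_derivMat hβ (N (intVec z))
  rw [hN, hz] at h
  exact (mul_left_cancel₀ (derivAt_ne_zero hβ) h).symm

lemma eq_zero_of_mem_kerLattice (hβ : IsPisotUnit β) {u : Fin (deg β) → ℝ}
    (hu : u ∈ kerLattice β) (h : unst β u = 0) : u = 0 := by
  obtain ⟨z, hz⟩ := mem_kerLattice_iff.1 hu
  have h1 : z = 0 := eq_zero_of_unst_intVec hβ (by rw [← hz, unst_derivMat hβ, h, mul_zero])
  obtain ⟨N, -, hN⟩ := exists_inverse_derivMat hβ
  rw [← hN u, hz, h1]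
  have : intVec (0 : Fin (deg β) → ℤ) = 0 := by funext i; simp [intVec]
  rw [this, map_zero]

lemma eq_of_mem_kerLattice (hβ : IsPisotUnit β) {u w : Fin (deg β) → ℝ}
    (hu : u ∈ kerLattice β) (hw : w ∈ kerLattice β) (h : unst β u = unst β w) : u = w :=
  sub_eq_zero.1 (eq_zero_of_mem_kerLattice hβ (sub_mem hu hw) (by rw [map_sub, h, sub_self]))

/-- The injective map `g'(M)` sends these points to a bounded set of integer vectors. -/
lemma finite_kerLattice_inter (hβ : IsPisotUnit β) (R : ℝ) :
    {u | u ∈ kerLattice β ∧ ‖u‖ ≤ R}.Finite := by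
  obtain ⟨N, -, hN⟩ := exists_inverse_derivMat hβ
  obtain ⟨D, hD⟩ := ((isCompact_closedBall (0 : Fin (deg β) → ℝ) R).image
    (continuous_act (derivMat β))).isBounded.exists_norm_le
  have hfin : {z : Fin (deg β) → ℤ | ‖z‖ ≤ D}.Finite := by
    have := (isCompact_closedBall (0 : Fin (deg β) → ℤ) D).finite_of_discrete
    simpa [Metric.closedBall, dist_zero_right] using this
  refine (hfin.image fun z => N (intVec z)).subset ?_
  rintro u ⟨hu, hR⟩
  obtain ⟨z, hz⟩ := mem_kerLattice_iff.1 hu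
  refine ⟨z, ?_, ?_⟩
  · have h1 := hD _ ⟨u, by simpa using hR, rfl⟩
    rw [hz] at h1
    have h2 : ‖intVec z‖ = ‖z‖ := by
      simp only [Pi.norm_def, intVec]
      congr 2
    rw [h2] at h1
    exact h1
  · change N (intVec z) = u
    rw [← hz, hN]

lemma finite_ker_derivMat (hβ : IsPisotUnit β) :
    {θ : Torus β | toralHom (derivMat β) θ = 0}.Finite := by
  refine ((finite_kerLattice_inter hβ 1).image torusMk).subset ?_
  intro θ hθ
  obtain ⟨v, rfl⟩ := torusMk_surjective θ
  have e : torusMk (fun i => Int.fract (v i)) = torusMk v := by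
    have : (fun i => Int.fract (v i)) = v - intVec fun i => ⌊v i⌋ := by
      funext i; simp [intVec, Int.self_sub_floor]
    rw [this, map_sub, torusMk_intVec, sub_zero]
  refine ⟨fun i => Int.fract (v i), ⟨?_, ?_⟩, e⟩
  · change toralHom (derivMat β) (torusMk _) = 0
    rw [e]; exact hθ
  · refine (pi_norm_le_iff_of_nonneg zero_le_one).2 fun i => ?_
    rw [Real.norm_of_nonneg (Int.fract_nonneg _)]
    exact (Int.fract_lt_one _).le

/-- The homomorphism `𝒫_β → 𝕋^m` with kernel `ℤ[β]` and image the kernel of `g'(T)`. -/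
noncomputable def pisotHom (hβ : IsPisotUnit β) : pisotP β →+ Torus β :=
  AddMonoidHom.mk' (fun ξ => torusMk (exists_mem_kerLattice hβ ξ.2).choose) fun ξ η => by
    rw [← map_add]
    congr 1
    have h1 := (exists_mem_kerLattice hβ ξ.2).choose_spec
    have h2 := (exists_mem_kerLattice hβ η.2).choose_spec
    have h3 := (exists_mem_kerLattice hβ (ξ + η).2).choose_spec
    refine eq_of_mem_kerLattice hβ h3.1 (add_mem h1.1 h2.1) ?_
    rw [map_add, h1.2, h2.2, h3.2, AddSubgroup.coe_add]

lemma exists_pisotHom_eq (hβ : IsPisotUnit β) (ξ : pisotP β) :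
    ∃ u ∈ kerLattice β, unst β u = ξ ∧ pisotHom hβ ξ = torusMk u :=
  ⟨_, (exists_mem_kerLattice hβ ξ.2).choose_spec.1, (exists_mem_kerLattice hβ ξ.2).choose_spec.2,
    rfl⟩

lemma pisotHom_unst (hβ : IsPisotUnit β) {u : Fin (deg β) → ℝ} (hu : u ∈ kerLattice β) :
    pisotHom hβ ⟨unst β u, unst_mem_pisotP hβ hu⟩ = torusMk u := by
  obtain ⟨w, hw, h1, h2⟩ := exists_pisotHom_eq hβ ⟨unst β u, unst_mem_pisotP hβ hu⟩
  rw [h2, eq_of_mem_kerLattice hβ hw hu h1]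

lemma toralHom_pisotHom (hβ : IsPisotUnit β) (ξ : pisotP β) :
    toralHom (derivMat β) (pisotHom hβ ξ) = 0 := by
  obtain ⟨u, hu, -, h⟩ := exists_pisotHom_eq hβ ξ
  rw [h]
  exact hu

lemma pisotHom_eq_zero_iff (hβ : IsPisotUnit β) (ξ : pisotP β) :
    pisotHom hβ ξ = 0 ↔ (ξ : ℝ) ∈ ringZ β := by
  obtain ⟨u, hu, h1, h2⟩ := exists_pisotHom_eq hβ ξ
  rw [h2, torusMk_eq_zero_iff, ← h1]
  constructor
  · rintro ⟨z, rfl⟩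
    exact unst_intVec_mem hβ z
  · intro h
    obtain ⟨z, hz⟩ := exists_unst_eq hβ h
    exact ⟨z, eq_of_mem_kerLattice hβ hu (intVec_mem_kerLattice z) hz.symm⟩

/-! ### Greedy and quasi-greedy orbits -/

/-- The orbit of `x` under `y ↦ {βy}`. -/
noncomputable def orbit (β x : ℝ) (n : ℕ) : ℝ := (fun y : ℝ => Int.fract (β * y))^[n] x

lemma orbit_zero (β x : ℝ) : orbit β x 0 = x := rfl

lemma orbit_succ (β x : ℝ) (n : ℕ) : orbit β x (n + 1) = Int.fract (β * orbit β x n) :=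
  Function.iterate_succ_apply' _ _ _

lemma orbit_add (β x : ℝ) (n k : ℕ) : orbit β x (n + k) = orbit β (orbit β x n) k := by
  rw [add_comm]
  exact Function.iterate_add_apply _ _ _ _

lemma digit_eq (β x : ℝ) (n : ℕ) : digit β x n = ⌊β * orbit β x n⌋₊ := rfl

lemma digit_add (β x : ℝ) (n k : ℕ) : digit β x (n + k) = digit β (orbit β x n) k := by
  rw [digit_eq, digit_eq, orbit_add]

lemma orbit_nonneg {x : ℝ} (hx : 0 ≤ x) (n : ℕ) : 0 ≤ orbit β x n := by
  cases n with
  | zero => exact hx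
  | succ n => rw [orbit_succ]; exact Int.fract_nonneg _

lemma orbit_lt_one {x : ℝ} (hx : x < 1) (n : ℕ) : orbit β x n < 1 := by
  cases n with
  | zero => exact hx
  | succ n => rw [orbit_succ]; exact Int.fract_lt_one _

lemma orbit_le_one {x : ℝ} (hx : x ≤ 1) (n : ℕ) : orbit β x n ≤ 1 := by
  cases n with
  | zero => exact hx
  | succ n => rw [orbit_succ]; exact (Int.fract_lt_one _).le

lemma fract_eq_sub_natFloor {a : ℝ} (ha : 0 ≤ a) : Int.fract a = a - ⌊a⌋₊ := by
  rw [Int.fract, natCast_floor_eq_intCast_floor ha]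

lemma orbit_succ_eq (hβ : 1 < β) {x : ℝ} (hx : 0 ≤ x) (n : ℕ) :
    orbit β x (n + 1) = β * orbit β x n - digit β x n := by
  rw [orbit_succ, digit_eq,
    fract_eq_sub_natFloor (mul_nonneg (one_pos.trans hβ).le (orbit_nonneg hx n))]

lemma nonpos_of_pow_mul_le (hβ : 1 < β) {c D : ℝ} (h : ∀ n : ℕ, β ^ n * c ≤ D) : c ≤ 0 := by
  by_contra hc
  rw [not_le] at hc
  obtain ⟨n, hn⟩ := pow_unbounded_of_one_lt (D / c) hβ
  rw [div_lt_iff₀ hc] at hn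
  exact absurd (h n) (not_le.2 hn)

/-- Two orbits with the same digits separate at the rate `β`. -/
lemma sub_eq_pow_mul {y x : ℕ → ℝ} {d e : ℕ → ℕ} (hy : ∀ n, y (n + 1) = β * y n - d n)
    (hx : ∀ n, x (n + 1) = β * x n - e n) (n : ℕ) (h : ∀ i < n, e i = d i) :
    y n - x n = β ^ n * (y 0 - x 0) := by
  induction n with
  | zero => simp
  | succ n ih =>
    rw [hy, hx, h n (Nat.lt_succ_self n), pow_succ', mul_assoc, ← ih fun i hi => h i (by omega)]
    ring

lemma orbit_eq_zero_of_digit (hβ : 1 < β) {x : ℝ} (hx : 0 ≤ x) (hx1 : x ≤ 1)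
    (h : ∀ n, digit β x n = 0) : x = 0 := by
  refine le_antisymm (nonpos_of_pow_mul_le hβ (D := 1) fun n => ?_) hx
  have := sub_eq_pow_mul (x := fun _ => 0) (e := fun _ => 0) (orbit_succ_eq hβ hx) (by simp) n
    fun i _ => (h i).symm
  simp only [sub_zero, orbit_zero] at this
  rw [← this]
  exact orbit_le_one hx1 n

lemma digit_zero (β : ℝ) (n : ℕ) : digit β 0 n = 0 := by
  have : orbit β 0 n = 0 := by
    induction n with
    | zero => rfl
    | succ n ih => rw [orbit_succ, ih, mul_zero, Int.fract_zero]
  rw [digit_eq, this, mul_zero, Nat.floor_zero]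

/-- The digits `d` come from an orbit of `1` in `(0, 1]`. -/
lemma exists_quasiGreedy_orbit (hβ : 1 < β) : ∃ y : ℕ → ℝ, y 0 = 1 ∧ (∀ n, 0 < y n) ∧
    (∀ n, y n ≤ 1) ∧ ∀ n, y (n + 1) = β * y n - quasiGreedy β n := by
  classical
  have hs := orbit_succ_eq hβ zero_le_one
  have hn := fun n => orbit_nonneg (β := β) zero_le_one n
  have h1 := fun n => orbit_le_one (β := β) le_rfl n
  by_cases h : ∃ K, ∀ j ≥ K, digit β 1 j = 0
  · set p := Nat.find h with hp
    have hz : ∀ j ≥ p, digit β 1 j = 0 := Nat.find_spec h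
    have hp0 : 0 < p := by
      rw [Nat.pos_iff_ne_zero]
      intro h0
      have := hz 0 (by omega)
      rw [digit_eq, orbit_zero, mul_one, Nat.floor_eq_zero] at this
      linarith
    have hne : ∀ j < p, orbit β 1 j ≠ 0 := by
      intro j hj h0
      have hj' : p ≤ j := Nat.find_min' h fun i hi => by
        obtain ⟨k, rfl⟩ := Nat.exists_eq_add_of_le hi
        rw [digit_add, h0, digit_zero]
      omega
    have hxp : orbit β 1 p = 0 := orbit_eq_zero_of_digit hβ (hn p) (h1 p) fun n => by
      rw [← digit_add]; exact hz _ (by omega)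
    have hdp : digit β 1 (p - 1) ≠ 0 := by
      intro h0
      have := Nat.find_min' h (m := p - 1) fun i hi => by
        rcases hi.eq_or_lt with rfl | hi
        · exact h0
        · exact hz _ (by omega)
      omega
    -- Lowering the last nonzero digit by one makes the orbit return to `1` where the greedy orbit
    -- would reach `0`, so it stays positive.
    refine ⟨fun n => orbit β 1 (n % p), by simp [orbit_zero], fun n =>
      lt_of_le_of_ne (hn _) (hne _ (Nat.mod_lt _ hp0)).symm, fun n => h1 _, fun n => ?_⟩
    have hlt := Nat.mod_lt n hp0
    rw [quasiGreedy, dif_pos h, ← hp]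
    by_cases hc : n % p + 1 = p
    · have e1 : (n + 1) % p = 0 := by rw [← Nat.mod_add_mod, hc, Nat.mod_self]
      have e2 : n % p = p - 1 := by omega
      have e3 := hs (p - 1)
      rw [Nat.sub_add_cancel hp0, hxp] at e3
      rw [if_pos hc]
      simp only [e1, e2, orbit_zero]
      rw [Nat.cast_sub (Nat.one_le_iff_ne_zero.2 hdp), Nat.cast_one]
      linarith
    · have e1 : (n + 1) % p = n % p + 1 := by
        rw [← Nat.mod_add_mod, Nat.mod_eq_of_lt (by omega)]
      rw [if_neg hc]
      simp only [e1]
      exact hs _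
  · refine ⟨orbit β 1, rfl, fun n => lt_of_le_of_ne (hn n) fun h0 => h ⟨n, fun j hj => ?_⟩, h1,
      fun n => ?_⟩
    · obtain ⟨k, rfl⟩ := Nat.exists_eq_add_of_le hj
      rw [digit_add, ← h0, digit_zero]
    · rw [quasiGreedy, dif_neg h]
      exact hs n

/-! ### Lexicographic estimates -/

lemma lexLT_trichotomy (s d : ℕ → ℕ) : LexLT s d ∨ s = d ∨ LexLT d s := by
  classical
  by_cases h : ∃ n, s n ≠ d n
  · have h1 := Nat.find_spec h
    have h2 : ∀ i < Nat.find h, s i = d i := fun i hi => not_not.1 (Nat.find_min h hi)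
    rcases lt_or_gt_of_ne h1 with h3 | h3
    · exact Or.inl ⟨_, h2, h3⟩
    · exact Or.inr (Or.inr ⟨_, fun i hi => (h2 i hi).symm, h3⟩)
  · exact Or.inr (Or.inl (funext fun n => not_not.1 fun hn => h ⟨n, hn⟩))

/-- An orbit in `[0, 1]` that starts below an orbit in `(0, 1]` does not have larger digits, if one
of the two inequalities is strict. -/
lemma not_lexLT_of_le (hβ : 1 < β) {y x : ℕ → ℝ} {d e : ℕ → ℕ}
    (hy : ∀ n, y (n + 1) = β * y n - d n) (hx : ∀ n, x (n + 1) = β * x n - e n)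
    (h0 : x 0 ≤ y 0) (h1 : ∀ n, y n - x n < 1 ∨ (y n - x n ≤ 1 ∧ x 0 < y 0)) : ¬ LexLT d e := by
  rintro ⟨n, h2, h3⟩
  have e1 := sub_eq_pow_mul hy hx n fun i hi => (h2 i hi).symm
  have e2 : y (n + 1) - x (n + 1) = β ^ (n + 1) * (y 0 - x 0) + (e n - d n) := by
    rw [hy, hx, pow_succ', mul_assoc, ← e1]
    ring
  have h4 : (d n : ℝ) + 1 ≤ e n := by exact_mod_cast h3
  have h5 : 0 < β ^ (n + 1) := pow_pos (one_pos.trans hβ) _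
  -- At the first larger digit the gap `y - x` gains at least `1` on top of its nonnegative scaled
  -- initial value.
  rcases h1 (n + 1) with h | ⟨h, h6⟩
  · have := mul_nonneg h5.le (sub_nonneg.2 h0)
    linarith
  · have := mul_pos h5 (sub_pos.2 h6)
    linarith

lemma not_lexLT_quasiGreedy_shift (hβ : 1 < β) (k : ℕ) :
    ¬ LexLT (quasiGreedy β) fun i => quasiGreedy β (k + i) := by
  obtain ⟨y, y0, hp, h1, hs⟩ := exists_quasiGreedy_orbit hβ
  refine not_lexLT_of_le hβ hs (x := fun n => y (k + n)) (fun n => hs (k + n)) ?_ fun n => Or.inl ?_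
  · rw [y0]; exact h1 _
  · have := hp (k + n)
    have := h1 n
    linarith

lemma lexLT_digit (hβ : 1 < β) {x : ℝ} (hx : 0 ≤ x) (hx1 : x < 1) :
    LexLT (digit β x) (quasiGreedy β) := by
  obtain ⟨y, y0, hp, h1, hs⟩ := exists_quasiGreedy_orbit hβ
  rcases lexLT_trichotomy (digit β x) (quasiGreedy β) with h | h | h
  · exact h
  · exfalso
    have := nonpos_of_pow_mul_le hβ (c := 1 - x) (D := 1) fun n => by
      have e := sub_eq_pow_mul hs (orbit_succ_eq hβ hx) n fun i _ => congrFun h i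
      rw [y0, orbit_zero] at e
      rw [← e]
      have := h1 n
      have := orbit_nonneg (β := β) hx n
      linarith
    linarith
  · refine absurd h (not_lexLT_of_le hβ hs (orbit_succ_eq hβ hx) ?_ fun n => Or.inr ⟨?_, ?_⟩)
    · rw [y0]; exact hx1.le
    · have := h1 n
      have := orbit_nonneg (β := β) hx n
      linarith
    · rw [y0]; exact hx1

lemma quasiGreedy_zero_pos (hβ : 1 < β) : 0 < quasiGreedy β 0 := by
  obtain ⟨y, y0, hp, h1, hs⟩ := exists_quasiGreedy_orbit hβ
  have h := hs 0
  rw [y0, mul_one] at h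
  have := h1 1
  have h2 : (0 : ℝ) < quasiGreedy β 0 := by linarith
  exact_mod_cast h2

lemma exists_quasiGreedy_ne_zero (hβ : 1 < β) (n : ℕ) : ∃ j ≥ n, quasiGreedy β j ≠ 0 := by
  obtain ⟨y, y0, hp, h1, hs⟩ := exists_quasiGreedy_orbit hβ
  by_contra! h
  have := nonpos_of_pow_mul_le hβ (c := y n) (D := 1) fun k => by
    have e := sub_eq_pow_mul (y := fun k => y (n + k)) (d := fun k => quasiGreedy β (n + k))
      (x := fun _ => 0) (e := fun _ => 0) (fun k => hs (n + k)) (by simp) k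
      fun i _ => (h (n + i) (by omega)).symm
    simp only [sub_zero, add_zero] at e
    rw [← e]
    exact h1 _
  exact absurd (hp n) (not_lt.2 this)

/-! ### Values of sequences -/

lemma val_eq_of_orbit (hβ : 1 < β) {y : ℕ → ℝ} {d : ℕ → ℕ} (h0 : ∀ n, 0 ≤ y n)
    (h1 : ∀ n, y n ≤ 1) (hs : ∀ n, y (n + 1) = β * y n - d n) : val β d = y 0 := by
  have hβ0 : 0 < β := one_pos.trans hβ
  refine HasSum.tsum_eq ?_
  rw [hasSum_iff_tendsto_nat_of_nonneg fun _ => by positivity]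
  have e : ∀ n, ∑ i ∈ Finset.range n, (d i : ℝ) * (β ^ (i + 1))⁻¹ = y 0 - y n * (β ^ n)⁻¹ := by
    intro n
    induction n with
    | zero => simp
    | succ n ih =>
      rw [Finset.sum_range_succ, ih, hs, pow_succ]
      field_simp
      ring
  simp only [e]
  have h2 : Tendsto (fun n => y n * (β ^ n)⁻¹) atTop (𝓝 0) := by
    refine squeeze_zero (fun n => mul_nonneg (h0 n) (by positivity)) (fun n => ?_)
      (tendsto_pow_atTop_nhds_zero_of_lt_one (inv_nonneg.2 hβ0.le) (inv_lt_one_of_one_lt₀ hβ))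
    rw [inv_pow]
    exact mul_le_of_le_one_left (by positivity) (h1 n)
  simpa using h2.const_sub (y 0)

lemma val_digit (hβ : 1 < β) {x : ℝ} (hx : 0 ≤ x) (hx1 : x < 1) : val β (digit β x) = x :=
  val_eq_of_orbit hβ (orbit_nonneg hx) (orbit_le_one hx1.le) (orbit_succ_eq hβ hx)

lemma val_quasiGreedy (hβ : 1 < β) : val β (quasiGreedy β) = 1 := by
  obtain ⟨y, y0, hp, h1, hs⟩ := exists_quasiGreedy_orbit hβ
  rw [val_eq_of_orbit hβ (fun n => (hp n).le) h1 hs, y0]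

lemma val_succ (hβ : 1 < β) {s : ℕ → ℕ} {c : ℕ} (hc : ∀ i, s i ≤ c) :
    val β (fun i => s (i + 1)) = β * val β s - s 0 := by
  have hβ0 : β ≠ 0 := (one_pos.trans hβ).ne'
  rw [val, val, (summable_val hβ hc).tsum_eq_zero_add, mul_add, ← tsum_mul_left]
  have e : ∀ i, β * ((s (i + 1) : ℝ) * (β ^ (i + 1 + 1))⁻¹) =
      (s (i + 1) : ℝ) * (β ^ (i + 1))⁻¹ := by
    intro i
    rw [pow_succ β (i + 1)]
    field_simp
  simp only [e, zero_add, pow_one]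
  field_simp
  ring

lemma val_nonneg (hβ : 1 < β) (s : ℕ → ℕ) : 0 ≤ val β s :=
  tsum_nonneg fun _ => mul_nonneg (Nat.cast_nonneg _)
    (inv_nonneg.2 (pow_nonneg (one_pos.trans hβ).le _))

lemma val_le (hβ : 1 < β) {s : ℕ → ℕ} {c : ℕ} (hc : ∀ i, s i ≤ c) :
    val β s ≤ val β fun _ => c := by
  have hβ0 : 0 < β := one_pos.trans hβ
  refine (summable_val hβ hc).tsum_le_tsum (fun i => ?_) (summable_val hβ fun _ => le_rfl)
  have := hc i
  gcongr

/-- If some tail had value at least `1`, then following it to its first digit below `d` gives a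
later tail whose excess over `1` is more than `β` times larger, because the orbit of `d` is
positive. Iterating contradicts the uniform bound on tail values. -/
lemma val_lt_one (hβ : 1 < β) {s : ℕ → ℕ}
    (h : ∀ k, LexLT (fun i => s (k + i)) (quasiGreedy β)) : val β s < 1 := by
  obtain ⟨y, y0, hp, h1, hs⟩ := exists_quasiGreedy_orbit hβ
  have hc : ∀ i, s i ≤ quasiGreedy β 0 := by
    intro k
    obtain ⟨n, h1, h2⟩ := h k
    cases n with
    | zero => simpa using h2.le
    | succ n => simpa using (h1 0 n.succ_pos).le
  set V : ℕ → ℝ := fun k => val β fun i => s (k + i) with hV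
  have hVs : ∀ k, V (k + 1) = β * V k - s k := by
    intro k
    have := val_succ hβ (s := fun i => s (k + i)) fun i => hc _
    simp only [hV]
    rw [add_zero] at this
    rw [← this]
    congr 2
    funext i
    congr 1
    ring
  have step : ∀ k, 1 ≤ V k → ∃ l, β * (V k - 1) < V l - 1 := by
    intro k hk
    obtain ⟨n, h2, h3⟩ := h k
    refine ⟨k + n + 1, ?_⟩
    have e := sub_eq_pow_mul hs (x := fun n => V (k + n)) (fun n => hVs (k + n)) n h2
    have h4 : (s (k + n) : ℝ) + 1 ≤ quasiGreedy β n := by exact_mod_cast h3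
    have e2 : y (n + 1) - V (k + n + 1) =
        β ^ (n + 1) * (1 - V k) - (quasiGreedy β n - s (k + n)) := by
      rw [hs, hVs, pow_succ', mul_assoc, ← y0]
      simp only [add_zero] at e
      rw [← e]
      ring
    have h5 := hp (n + 1)
    have h6 : β * (V k - 1) ≤ β ^ (n + 1) * (V k - 1) := by
      refine mul_le_mul_of_nonneg_right ?_ (sub_nonneg.2 hk)
      exact le_self_pow₀ hβ.le n.succ_ne_zero
    linarith
  have hV0 : val β s = V 0 := by simp [hV]
  rw [hV0]
  by_contra hcon
  rw [not_lt] at hcon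
  obtain ⟨l, hl⟩ := step 0 hcon
  have hβ0 : 0 < β := one_pos.trans hβ
  have hl0 : 0 < V l - 1 := lt_of_le_of_lt (mul_nonneg hβ0.le (sub_nonneg.2 hcon)) hl
  have grow : ∀ n : ℕ, ∃ k, β ^ n * (V l - 1) ≤ V k - 1 := by
    intro n
    induction n with
    | zero => exact ⟨l, by simp⟩
    | succ n ih =>
      obtain ⟨k, hk⟩ := ih
      have : 0 ≤ V k - 1 := le_trans (by positivity) hk
      obtain ⟨q, hq⟩ := step k (by linarith)
      refine ⟨q, le_trans ?_ hq.le⟩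
      rw [pow_succ', mul_assoc]
      gcongr
  refine absurd hl0 (not_lt.2 (nonpos_of_pow_mul_le hβ
    (D := (val β fun _ => quasiGreedy β 0) - 1) fun n => ?_))
  obtain ⟨k, hk⟩ := grow n
  exact hk.trans (sub_le_sub_right (val_le hβ fun i => hc _) 1)

/-! ### Sequences of the compactum -/

/-- The value `∑_{k ≥ 1} ε_{j+k} β^{-k}` of the tail after the index `j`. -/
noncomputable def tailVal (β : ℝ) (ε : ℤ → ℕ) (j : ℤ) : ℝ := val β fun i => ε (1 + i + j)

lemma tailVal_lt_one (hβ : 1 < β) (ε : compactum β) (j : ℤ) : tailVal β ε.1 j < 1 := by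
  refine val_lt_one hβ fun k => ?_
  convert ε.2 (1 + k + j) using 3 with i
  push_cast
  ring

lemma tailVal_succ (hβ : 1 < β) (ε : compactum β) (j : ℤ) :
    tailVal β ε.1 (j + 1) = β * tailVal β ε.1 j - ε.1 (1 + j) := by
  have := val_succ hβ (s := fun i => ε.1 (1 + i + j)) fun i => compactum_le ε _
  rw [tailVal, tailVal]
  simp only [Nat.cast_zero, add_zero] at this
  rw [← this]
  exact congrArg (val β) (funext fun i => congrArg ε.1 (by push_cast; ring))

lemma tailVal_nonneg (hβ : 1 < β) (ε : ℤ → ℕ) (j : ℤ) : 0 ≤ tailVal β ε j := val_nonneg hβ _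

/-- Since every tail has value in `[0, 1)`, the recursion for tail values is division with
remainder: each digit is greedy, and tail values form an orbit of `y ↦ {βy}`. -/
lemma eq_floor_tailVal (hβ : 1 < β) (ε : compactum β) (j : ℤ) :
    ε.1 (1 + j) = ⌊β * tailVal β ε.1 j⌋₊ := by
  have h1 := tailVal_succ hβ ε j
  have h2 := tailVal_lt_one hβ ε (j + 1)
  have h3 := tailVal_nonneg hβ ε.1 (j + 1)
  refine ((Nat.floor_eq_iff (mul_nonneg (one_pos.trans hβ).le (tailVal_nonneg hβ ε.1 j))).2
    ⟨?_, ?_⟩).symm <;> linarith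

lemma tailVal_succ_eq_fract (hβ : 1 < β) (ε : compactum β) (j : ℤ) :
    tailVal β ε.1 (j + 1) = Int.fract (β * tailVal β ε.1 j) := by
  rw [fract_eq_sub_natFloor (mul_nonneg (one_pos.trans hβ).le (tailVal_nonneg hβ _ _)),
    ← eq_floor_tailVal hβ, tailVal_succ hβ]

lemma orbit_tailVal (hβ : 1 < β) (ε : compactum β) (j : ℤ) (n : ℕ) :
    orbit β (tailVal β ε.1 j) n = tailVal β ε.1 (j + n) := by
  induction n with
  | zero => simp [orbit_zero]
  | succ n ih => rw [orbit_succ, ih, ← tailVal_succ_eq_fract hβ, Nat.cast_succ, add_assoc]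

lemma digit_tailVal (hβ : 1 < β) (ε : compactum β) (j : ℤ) (n : ℕ) :
    digit β (tailVal β ε.1 j) n = ε.1 (1 + (j + n)) := by
  rw [digit_eq, orbit_tailVal hβ, eq_floor_tailVal hβ]

open Classical in
/-- The greedy expansion of `x ∈ [0, 1)` as a two-sided sequence. -/
noncomputable def expansion (β x : ℝ) (k : ℤ) : ℕ := if k ≤ 0 then 0 else digit β x (k - 1).toNat

lemma expansion_of_nonpos (β x : ℝ) {k : ℤ} (hk : k ≤ 0) : expansion β x k = 0 := if_pos hk

lemma expansion_one_add (β x : ℝ) (n : ℕ) : expansion β x (1 + n) = digit β x n := by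
  rw [expansion, if_neg (by omega)]
  congr
  omega

lemma expansion_mem (hβ : 1 < β) {x : ℝ} (hx : 0 ≤ x) (hx1 : x < 1) :
    expansion β x ∈ compactum β := by
  intro n
  rcases le_or_gt n 0 with hn | hn
  · refine ⟨0, by simp, ?_⟩
    simp only [Nat.cast_zero, add_zero, expansion_of_nonpos β x hn]
    exact quasiGreedy_zero_pos hβ
  · obtain ⟨k, rfl⟩ : ∃ k : ℕ, n = 1 + k := ⟨(n - 1).toNat, by omega⟩
    convert lexLT_digit hβ (orbit_nonneg (β := β) hx k) (orbit_lt_one hx1 k) using 1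
    funext i
    rw [← digit_add, ← expansion_one_add]
    congr 1
    push_cast
    ring

/-! ### The closed compactum -/

/-- The sequences all of whose tails are lexicographically at most `d`. -/
def closedCompactum (β : ℝ) : Set (ℤ → ℕ) :=
  {ε | ∀ n : ℤ, ¬ LexLT (quasiGreedy β) fun i : ℕ => ε (n + i)}

lemma LexLT.asymm {s d : ℕ → ℕ} (h : LexLT s d) : ¬ LexLT d s := by
  obtain ⟨n, h1, h2⟩ := h
  rintro ⟨k, h3, h4⟩
  rcases lt_trichotomy n k with h | rfl | h
  · have := h3 n h; omega
  · omega
  · have := h1 k h; omega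

lemma compactum_subset_closedCompactum : compactum β ⊆ closedCompactum β :=
  fun _ h n => (h n).asymm

lemma closedCompactum_le {ε : ℤ → ℕ} (h : ε ∈ closedCompactum β) (k : ℤ) :
    ε k ≤ quasiGreedy β 0 := by
  by_contra hk
  exact h k ⟨0, by simp, by simpa using hk⟩

lemma isClosed_closedCompactum (β : ℝ) : IsClosed (closedCompactum β) := by
  have e : closedCompactum β =
      ⋂ n : ℤ, {ε | LexLT (quasiGreedy β) fun i : ℕ => ε (n + i)}ᶜ := by
    ext ε; simp [closedCompactum]
  rw [e]
  refine isClosed_iInter fun n => IsOpen.isClosed_compl ?_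
  have e2 : {ε : ℤ → ℕ | LexLT (quasiGreedy β) fun i : ℕ => ε (n + i)} =
      ⋃ k : ℕ, (⋂ i ∈ Finset.range k, {ε : ℤ → ℕ | quasiGreedy β i = ε (n + i)}) ∩
        {ε | quasiGreedy β k < ε (n + k)} := by
    ext ε; simp [LexLT]
  rw [e2]
  refine isOpen_iUnion fun k => IsOpen.inter (isOpen_biInter_finset fun i _ => ?_) ?_
  · exact (isOpen_discrete {x : ℕ | quasiGreedy β i = x}).preimage (continuous_apply (n + i : ℤ))
  · exact (isOpen_discrete {x : ℕ | quasiGreedy β k < x}).preimage (continuous_apply (n + k : ℤ))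

lemma isCompact_closedCompactum (β : ℝ) : IsCompact (closedCompactum β) := by
  have h := isCompact_univ_pi fun _ : ℤ => (Set.finite_Iic (quasiGreedy β 0)).isCompact
  exact h.of_isClosed_subset (isClosed_closedCompactum β) fun ε h k _ => closedCompactum_le h k

lemma isClosed_image_closedCompactum (hβ : IsPisotUnit β) :
    IsClosed ((fun ε => torusMk (realCode β ε)) '' closedCompactum β) := by
  refine ((isCompact_closedCompactum β).image_of_continuousOn ?_).isClosed
  exact continuous_torusMk.comp_continuousOn
    ((continuousOn_realCode hβ (quasiGreedy β 0)).mono fun ε h k => closedCompactum_le h k)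

/-! ### Density of the unstable line -/

lemma norm_torusMk_le {m : ℕ} (v : Fin m → ℝ) : ‖torusMk v‖ ≤ ‖v‖ := by
  refine (pi_norm_le_iff_of_nonneg (norm_nonneg v)).2 fun i => ?_
  exact (QuotientAddGroup.norm_mk_le_norm).trans (norm_le_pi_norm v i)

lemma exists_norm_act_lt (hβ : IsPisotUnit β) (R : ℝ) {δ : ℝ} (hδ : 0 < δ) : ∃ N : ℕ, ∀ n ≥ N,
    ∀ v, ‖v‖ ≤ R → ‖act (companion β ^ n) (stab β v)‖ < δ := by
  obtain ⟨ρ, D, h0, h1, hD, h⟩ := exists_contraction hβ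
  have ht : Tendsto (fun n : ℕ => D * ρ ^ n * R) atTop (𝓝 0) := by
    simpa using ((tendsto_pow_atTop_nhds_zero_of_lt_one h0.le h1).const_mul D).mul_const R
  obtain ⟨N, hN⟩ := eventually_atTop.1 (ht.eventually (gt_mem_nhds hδ))
  refine ⟨N, fun n hn v hv => ((h v n).trans ?_).trans_lt (hN n hn)⟩
  gcongr

/-- Write `θ` as `T ^ N` of a point with a lift in a bounded region. Discarding the stable part of
that lift costs little after `T ^ N`, and what remains is on the unstable line. -/
lemma exists_baseVec_close (hβ : IsPisotUnit β) (θ : Torus β) {δ : ℝ} (hδ : 0 < δ) :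
    ∃ x : ℝ, 0 ≤ x ∧ x < 1 ∧ ∃ n : ℕ,
      ‖θ - toralMap (companion β ^ (n : ℤ)) (torusMk (x • baseVec β))‖ < δ := by
  obtain ⟨z, hz⟩ := exists_unst_eq_one hβ
  obtain ⟨J, hJ⟩ := ((isCompact_closedBall (0 : Fin (deg β) → ℝ) 1).image
    (continuous_unst β)).isBounded.exists_norm_le
  -- Adding `j • z` makes the unstable component nonnegative without moving the torus point;
  -- dividing by `β ^ K` then brings it below `1`.
  set j : ℤ := ⌈J⌉
  have hjJ : J ≤ j := Int.le_ceil J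
  obtain ⟨K, hK⟩ := pow_unbounded_of_one_lt (J + j) hβ.one_lt
  obtain ⟨N, hN⟩ := exists_norm_act_lt hβ (1 + ‖intVec (j • z)‖) hδ
  obtain ⟨v, rfl⟩ := torusMk_surjective θ
  set w := act (companion β ^ (-(N : ℤ))) v with hw
  set r : Fin (deg β) → ℝ := fun i => Int.fract (w i) with hr
  have hr1 : ‖r‖ ≤ 1 := by
    refine (pi_norm_le_iff_of_nonneg zero_le_one).2 fun i => ?_
    rw [Real.norm_of_nonneg (Int.fract_nonneg _)]
    exact (Int.fract_lt_one _).le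
  have hur := hJ (unst β r) ⟨r, by simpa using hr1, rfl⟩
  rw [Real.norm_eq_abs, abs_le] at hur
  set r' := r + intVec (j • z) with hr'
  have hw' : w = r' + intVec ((fun i => ⌊w i⌋) - j • z) := by
    rw [hr', intVec_sub]
    funext i
    simp [hr, intVec]
  have hu : unst β r' = unst β r + j := by
    have : intVec (j • z) = (j : ℝ) • intVec z := by funext i; simp [intVec]
    rw [hr', map_add, this, map_smul, hz, smul_eq_mul, mul_one]
  have hpow : 0 < β ^ K := pow_pos (pos hβ) K
  refine ⟨unst β r' / β ^ K, div_nonneg (by linarith) hpow.le, ?_, N + K, ?_⟩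
  · rw [div_lt_one hpow]
    linarith
  have hv : v = act (companion β ^ (N : ℤ)) w := by
    rw [hw, ← act_zpow_add hβ, add_neg_cancel, zpow_zero, act_one]
  have e1 : act (companion β ^ ((N + K : ℕ) : ℤ)) ((unst β r' / β ^ K) • baseVec β) =
      act (companion β ^ (N : ℤ)) (unst β r' • baseVec β) := by
    rw [map_smul, map_smul, act_baseVec hβ, act_baseVec hβ, smul_smul, smul_smul, zpow_natCast,
      zpow_natCast, pow_add]
    congr 1
    field_simp
  have e2 : torusMk v = torusMk (act (companion β ^ (N : ℤ)) r') := by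
    rw [hv, hw', map_add, act_intVec, map_add, torusMk_intVec, add_zero]
  rw [toralMap_torusMk, e1, e2, ← map_sub, ← map_sub, ← stab_apply, zpow_natCast]
  refine (norm_torusMk_le _).trans_lt (hN N le_rfl r' ?_)
  exact (norm_add_le _ _).trans (add_le_add_left hr1 _)

/-- Shifted greedy expansions code the points `T ^ n (x t₀)` with `x ∈ [0, 1)`, which are dense, and
the image of the closed compactum is closed. -/
lemma exists_closedCompactum_eq (hβ : IsPisotUnit β) (θ : Torus β) :
    ∃ ε ∈ closedCompactum β, torusMk (realCode β ε) = θ := by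
  have h : θ ∈ closure ((fun ε => torusMk (realCode β ε)) '' closedCompactum β) := by
    refine Metric.mem_closure_iff.2 fun δ hδ => ?_
    obtain ⟨x, hx, hx1, n, hn⟩ := exists_baseVec_close hβ θ hδ
    have hmem := expansion_mem hβ.one_lt hx hx1
    have hc : ∀ k, expansion β x k ≤ quasiGreedy β 0 := compactum_le ⟨_, hmem⟩
    refine ⟨_, ⟨fun k => expansion β x (k + n), fun k => ?_, rfl⟩, ?_⟩
    · convert compactum_subset_closedCompactum hmem (k + n) using 4
      ring
    · have e : (fun i : ℕ => expansion β x (1 + i)) = digit β x :=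
        funext fun i => expansion_one_add β x i
      simp only
      rw [torusMk_realCode_shift hβ hc,
        realCode_of_nonpos hβ hc fun k hk => expansion_of_nonpos β x hk, e,
        val_digit hβ.one_lt hx hx1, dist_eq_norm]
      exact hn
  rwa [(isClosed_image_closedCompactum hβ).closure_eq] at h

/-! ### Reduction to the compactum -/

/-- All terms of positive index are multiples of `t₀`, so they enter only through their value. -/
lemma realCode_eq_of_val_eq (hβ : IsPisotUnit β) {ε δ : ℤ → ℕ} {c : ℕ} (hε : ∀ k, ε k ≤ c)
    (hδ : ∀ k, δ k ≤ c) (h : ∀ k ≤ 0, ε k = δ k)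
    (hv : val β (fun i => ε (1 + i)) = val β fun i => δ (1 + i)) :
    realCode β ε = realCode β δ := by
  have s1 := summable_val hβ.one_lt fun i : ℕ => hε (1 + i)
  have s2 := summable_val hβ.one_lt fun i : ℕ => hδ (1 + i)
  rw [← sub_eq_zero, realCode, realCode,
    ← (summable_realCode hβ hε).tsum_sub (summable_realCode hβ hδ),
    tsum_int_of_nonpos fun k hk => by rw [h k hk, sub_self]]
  rw [← sub_eq_zero, val, val, ← s1.tsum_sub s2] at hv
  rw [← zero_smul ℝ (baseVec β), ← hv, ← (s1.sub s2).tsum_smul_const]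
  refine tsum_congr fun i => ?_
  rw [liftTerm_of_pos hβ (by positivity), zpow_neg_one_add, smul_smul, smul_smul, sub_smul]

/-- The sequence with the tail from `n` on replaced by a carry. -/
def carry (ε : ℤ → ℕ) (n : ℤ) (k : ℤ) : ℕ :=
  if k < n - 1 then ε k else if k = n - 1 then ε k + 1 else 0

/-- Minimality of `n` makes each earlier tail strictly smaller than `d`; the cases are whether its
first smaller digit lies before, at or after the incremented place `n - 1`. -/
lemma carry_mem (hβ : IsPisotUnit β) {ε : ℤ → ℕ} (hε : ε ∈ closedCompactum β) {n : ℤ}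
    (hn : (fun i : ℕ => ε (n + i)) = quasiGreedy β)
    (hmin : ∀ j < n, (fun i : ℕ => ε (j + i)) ≠ quasiGreedy β) : carry ε n ∈ compactum β := by
  intro j
  rcases le_or_gt n j with hj | hj
  · refine ⟨0, by simp, ?_⟩
    have : carry ε n j = 0 := by rw [carry, if_neg (by omega), if_neg (by omega)]
    simpa [this] using quasiGreedy_zero_pos hβ.one_lt
  obtain ⟨i, h1, h2⟩ : LexLT (fun i : ℕ => ε (j + i)) (quasiGreedy β) :=
    (lexLT_trichotomy _ _).resolve_right (not_or.2 ⟨hmin j hj, hε j⟩)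
  replace h2 : ε (j + i) < quasiGreedy β i := h2
  have hlt : ∀ k : ℕ, j + k < n - 1 → carry ε n (j + k) = ε (j + k) := fun k hk => if_pos hk
  rcases lt_trichotomy (j + i) (n - 1) with hi | hi | hi
  · refine ⟨i, fun k hk => ?_, ?_⟩
    · rw [← h1 k hk]; exact hlt k (by omega)
    · exact (hlt i hi).trans_lt h2
  · have hci : carry ε n (j + i) = ε (j + i) + 1 := by
      rw [carry, if_neg (by omega), if_pos hi]
    have hcb : ∀ k < i, carry ε n (j + k) = quasiGreedy β k := fun k hk => by
      rw [← h1 k hk]; exact hlt k (by omega)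
    have hca : ∀ k : ℕ, i < k → carry ε n (j + k) = 0 := fun k hk => by
      rw [carry, if_neg (by omega), if_neg (by omega)]
    rcases (Nat.succ_le_of_lt h2).lt_or_eq with h3 | h3
    · exact ⟨i, hcb, hci.trans_lt h3⟩
    -- Here the carried tail agrees with `d` up to the incremented place and is zero afterwards; it
    -- is strictly below because `d` has infinitely many nonzero digits.
    · rcases lexLT_trichotomy (fun k : ℕ => carry ε n (j + k)) (quasiGreedy β) with h | h | h
      · exact h
      · obtain ⟨k, hk, hne⟩ := exists_quasiGreedy_ne_zero hβ.one_lt (i + 1)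
        exact absurd ((congrFun h k).symm.trans (hca k (by omega))) hne
      · obtain ⟨k, h4, h5⟩ := h
        rcases lt_trichotomy k i with hk | rfl | hk
        · have := hcb k hk; simp only at h5; omega
        · simp only at h5; omega
        · have := hca k hk; simp only at h5; omega
  -- The tail first falls below `d` inside the copy of `d` starting at `n`, so a shift of `d` would
  -- exceed `d`.
  · exfalso
    obtain ⟨q, hq⟩ : ∃ q : ℕ, n = j + q := ⟨(n - j).toNat, by omega⟩
    have hd : ∀ t : ℕ, quasiGreedy β t = ε (j + (q + t : ℕ)) := fun t => by
      rw [← congrFun hn t, hq]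
      push_cast
      rw [add_assoc]
    refine not_lexLT_quasiGreedy_shift hβ.one_lt q ⟨i - q, fun t ht => ?_, ?_⟩
    · rw [hd t]; exact h1 (q + t) (by omega)
    · simp only
      rw [hd (i - q), show q + (i - q) = i by omega]
      exact h2

lemma torusMk_carry (hβ : IsPisotUnit β) {ε : ℤ → ℕ} (hε : ε ∈ closedCompactum β) {n : ℤ}
    (hn : (fun i : ℕ => ε (n + i)) = quasiGreedy β) :
    torusMk (realCode β (carry ε n)) = torusMk (realCode β ε) := by
  set c := quasiGreedy β 0 + 1
  have h1 : ∀ k, ε k ≤ c := fun k => (closedCompactum_le hε k).trans (Nat.le_succ _)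
  have h2 : ∀ k, carry ε n k ≤ c := by
    intro k
    have := closedCompactum_le hε k
    rw [carry]
    split_ifs <;> omega
  -- After this shift the place `n - 1` has index `1`, so only digits of positive index change;
  -- their values agree because `d` has value `1`.
  apply toralMap_zpow_injective hβ (n - 2)
  rw [← torusMk_realCode_shift hβ h1, ← torusMk_realCode_shift hβ h2]
  congr 1
  refine realCode_eq_of_val_eq hβ (fun k => h2 _) (fun k => h1 _) (fun k hk => ?_) ?_
  · exact if_pos (by omega)
  · have hβ0 : β ≠ 0 := (pos hβ).ne'
    have e1 := val_succ hβ.one_lt (s := fun i : ℕ => ε (1 + i + (n - 2))) fun i => h1 _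
    have e2 := val_succ hβ.one_lt (s := fun i : ℕ => carry ε n (1 + i + (n - 2))) fun i => h2 _
    have e3 : (fun i : ℕ => ε (1 + (i + 1 : ℕ) + (n - 2))) = quasiGreedy β := by
      rw [← hn]
      funext i
      congr 1
      push_cast
      ring
    have e4 : ∀ i : ℕ, carry ε n (1 + (i + 1 : ℕ) + (n - 2)) = 0 := fun i => by
      rw [carry, if_neg (by push_cast; omega), if_neg (by push_cast; omega)]
    have e5 : carry ε n (1 + (0 : ℕ) + (n - 2)) = ε (1 + (0 : ℕ) + (n - 2)) + 1 := by
      rw [carry, if_neg (by push_cast; omega), if_pos (by push_cast; ring)]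
    rw [e3, val_quasiGreedy hβ.one_lt] at e1
    simp only [e4, e5] at e2
    have e6 : (val β fun _ => 0) = 0 := by simp [val]
    rw [e6] at e2
    rw [Nat.cast_add, Nat.cast_one] at e2
    refine mul_left_cancel₀ hβ0 ?_
    linarith

/-- Shifted to a tail equal to `d`, the lift has unstable component `1`, so subtracting `z` leaves a
stable vector of bounded norm. Such tails occur arbitrarily far to the left, so arbitrarily high
powers of `T` bring these vectors back to the same torus point. -/
lemma torusMk_realCode_eq_zero (hβ : IsPisotUnit β) {ε : ℤ → ℕ} (hε : ε ∈ closedCompactum β)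
    (h : ∀ N : ℤ, ∃ n ≤ N, (fun i : ℕ => ε (n + i)) = quasiGreedy β) :
    torusMk (realCode β ε) = 0 := by
  have hc := closedCompactum_le hε
  obtain ⟨z, hz⟩ := exists_unst_eq_one hβ
  rw [← norm_le_zero_iff]
  refine le_of_forall_pos_le_add fun δ hδ => ?_
  rw [zero_add]
  obtain ⟨N, hN⟩ := exists_norm_act_lt hβ
    ((∑' k, (quasiGreedy β 0 : ℝ) * ‖liftTerm β k‖) + ‖intVec z‖) hδ
  obtain ⟨n, hn, hd⟩ := h (1 - N)
  obtain ⟨k, rfl⟩ : ∃ k : ℕ, n = 1 + -(k : ℤ) := ⟨(1 - n).toNat, by omega⟩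
  have h1 := torusMk_realCode_shift hβ hc (-(k : ℤ))
  set w := realCode β (fun i => ε (i + -(k : ℤ))) with hw
  have hu : unst β w = 1 := by
    rw [hw, unst_realCode hβ fun i => hc _, ← val_quasiGreedy hβ.one_lt, ← hd]
    congr 1
    funext i
    congr 1
    ring
  have h2 : torusMk (realCode β ε) = torusMk (act (companion β ^ k) (stab β (w - intVec z))) := by
    have h3 : stab β (w - intVec z) = w - intVec z := by
      rw [stab_apply, map_sub, hu, hz, sub_self, zero_smul, sub_zero]
    rw [h3, map_sub, act_intVec, map_sub, torusMk_intVec, sub_zero, ← toralMap_torusMk, h1,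
      ← zpow_natCast, ← toralMap_zpow_add hβ, add_neg_cancel, zpow_zero, toralMap_one]
  rw [h2]
  refine (norm_torusMk_le _).trans (hN k (by omega) _ ?_).le
  exact (norm_sub_le _ _).trans (add_le_add_left (norm_realCode_le hβ fun i => hc _) _)

lemma zero_mem_compactum (hβ : 1 < β) : (fun _ => 0) ∈ compactum β :=
  fun _ => ⟨0, by simp, quasiGreedy_zero_pos hβ⟩

lemma phiZero_surjective (hβ : IsPisotUnit β) : Function.Surjective (phiZero β) := by
  intro θ
  obtain ⟨ε, hε, rfl⟩ := exists_closedCompactum_eq hβ θ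
  by_cases h : ∃ n : ℤ, (fun i : ℕ => ε (n + i)) = quasiGreedy β
  · by_cases hb : ∃ b : ℤ, ∀ n : ℤ, (fun i : ℕ => ε (n + i)) = quasiGreedy β → b ≤ n
    · obtain ⟨n, hn, hmin⟩ := Int.exists_least_of_bdd hb h
      refine ⟨⟨carry ε n, carry_mem hβ hε hn fun j hj hj' => absurd (hmin j hj') (not_le.2 hj)⟩, ?_⟩
      rw [phiZero_eq hβ, torusMk_carry hβ hε hn]
    · push Not at hb
      refine ⟨⟨_, zero_mem_compactum hβ.one_lt⟩, ?_⟩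
      rw [phiZero_eq hβ, torusMk_realCode_eq_zero hβ hε fun N => ?_]
      · simp [realCode]
      · obtain ⟨n, h1, h2⟩ := hb N
        exact ⟨n, h2.le, h1⟩
  · refine ⟨⟨ε, fun n => ?_⟩, phiZero_eq hβ _⟩
    exact (lexLT_trichotomy _ _).resolve_right (not_or.2 ⟨fun h' => h ⟨n, h'⟩, hε n⟩)

/-! ### Periodicity over the kernel of `g'(T)` -/

/-- A two-sided orbit makes `f` surjective on its range; on a finite range it is then a permutation,
so the period holds for all indices and not only eventually. -/
lemma exists_period_of_finite_range {α : Type*} (f : α → α) (x : ℤ → α)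
    (hx : ∀ j, x (j + 1) = f (x j)) (hfin : (Set.range x).Finite) :
    ∃ p : ℕ, 0 < p ∧ ∀ j, x (j + p) = x j := by
  have : Finite (Set.range x) := hfin
  let g : Set.range x → Set.range x := fun a => ⟨f a, by
    obtain ⟨j, hj⟩ := a.2
    exact ⟨j + 1, by rw [hx, hj]⟩⟩
  have hg : Function.Surjective g := by
    rintro ⟨_, j, rfl⟩
    exact ⟨⟨x (j - 1), j - 1, rfl⟩, Subtype.ext ((hx (j - 1)).symm.trans (by rw [sub_add_cancel]))⟩
  let σ : Equiv.Perm (Set.range x) :=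
    Equiv.ofBijective g ⟨Finite.injective_iff_surjective.2 hg, hg⟩
  have hσ : ∀ (n : ℕ) j, ((σ ^ n) ⟨x j, j, rfl⟩ : Set.range x).1 = x (j + n) := by
    intro n
    induction n with
    | zero => intro j; simp
    | succ n ih =>
      intro j
      rw [pow_succ', Equiv.Perm.mul_apply, Nat.cast_succ, ← add_assoc, hx, ← ih]
      rfl
  refine ⟨orderOf σ, orderOf_pos σ, fun j => ?_⟩
  rw [← hσ, pow_orderOf_eq_one]
  rfl

lemma toralHom_derivMat_zpow (j : ℤ) (θ : Torus β) :
    toralHom (derivMat β) (toralMap (companion β ^ j) θ) =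
      toralMap (companion β ^ j) (toralHom (derivMat β) θ) := by
  have h : Commute (derivMat β) (companion β) := by
    have := congrArg (aeval (companion β)) (mul_comm (derivative (minpoly ℤ β)) X)
    rwa [map_mul, map_mul, aeval_X] at this
  rw [toralHom_apply, toralHom_apply, ← toralMap_mul, ← toralMap_mul,
    (Matrix.Commute.zpow_right h j).eq]

lemma unst_realCode_shift (hβ : IsPisotUnit β) (ε : compactum β) (j : ℤ) :
    unst β (realCode β fun k => ε.1 (k + j)) = tailVal β ε.1 j :=
  unst_realCode hβ fun _ => compactum_le ε _

lemma realCode_shift_mem_kerLattice (hβ : IsPisotUnit β) {ε : compactum β}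
    (h : toralHom (derivMat β) (phiZero β ε) = 0) (j : ℤ) :
    (realCode β fun k => ε.1 (k + j)) ∈ kerLattice β := by
  change toralHom (derivMat β) (torusMk _) = 0
  rw [torusMk_realCode_shift hβ (compactum_le ε), ← phiZero_eq hβ, toralHom_derivMat_zpow, h]
  exact map_zero (toralHom _)

lemma exists_period (hβ : IsPisotUnit β) {ε : compactum β}
    (h : toralHom (derivMat β) (phiZero β ε) = 0) :
    ∃ p : ℕ, 0 < p ∧ ∀ k : ℤ, ε.1 (k + p) = ε.1 k := by
  have hfin : (Set.range (tailVal β ε.1)).Finite := by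
    refine ((finite_kerLattice_inter hβ (∑' k, (quasiGreedy β 0 : ℝ) * ‖liftTerm β k‖)).image
      (unst β)).subset ?_
    rintro _ ⟨j, rfl⟩
    exact ⟨_, ⟨realCode_shift_mem_kerLattice hβ h j,
      norm_realCode_le hβ fun _ => compactum_le ε _⟩, unst_realCode_shift hβ ε j⟩
  obtain ⟨p, hp, hper⟩ := exists_period_of_finite_range (fun y => Int.fract (β * y))
    (tailVal β ε.1) (tailVal_succ_eq_fract hβ.one_lt ε) hfin
  refine ⟨p, hp, fun k => ?_⟩
  have e1 := eq_floor_tailVal hβ.one_lt ε (k - 1 + p)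
  have e2 := eq_floor_tailVal hβ.one_lt ε (k - 1)
  rw [hper, ← e2] at e1
  convert e1 using 2 <;> ring

/-! ### The fibres of `φ₀` over the kernel -/

lemma mk_eq_mk_iff (hβ : IsPisotUnit β) (ξ η : pisotP β) :
    (QuotientAddGroup.mk ξ : PisotGroup β) = QuotientAddGroup.mk η ↔
      pisotHom hβ ξ = pisotHom hβ η := by
  rw [QuotientAddGroup.eq, AddSubgroup.mem_addSubgroupOf, ← pisotHom_eq_zero_iff hβ, map_add,
    map_neg, neg_add_eq_zero]

lemma isBetaExpansion_expansion {x : ℝ} (hx : 0 ≤ x) (hx1 : x < 1) :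
    IsBetaExpansion β x (expansion β x) := by
  refine ⟨0, hx, by simpa using hx1, fun n => ?_,
    fun k hk => expansion_of_nonpos β x (by simpa using hk)⟩
  rw [pow_zero, div_one, ← expansion_one_add]
  congr 1
  push_cast
  ring

/-- The representative of the class is the tail value of `ε` itself: it is the unstable component of
the lift, and its greedy expansion is the tail of `ε`. -/
lemma mem_symbolicClass_of_phiZero_eq (hβ : IsPisotUnit β) {ε : compactum β} {ξ : pisotP β}
    (h : phiZero β ε = pisotHom hβ ξ) : ε ∈ symbolicClass β (QuotientAddGroup.mk ξ) := by
  have hk : toralHom (derivMat β) (phiZero β ε) = 0 := by rw [h, toralHom_pisotHom]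
  have hx : tailVal β ε.1 0 ∈ pisotP β := by
    rw [← unst_realCode_shift hβ]
    exact unst_mem_pisotP hβ (realCode_shift_mem_kerLattice hβ hk 0)
  have h0 := tailVal_nonneg hβ.one_lt ε.1 0
  refine ⟨exists_period hβ hk, ⟨tailVal β ε.1 0, hx⟩, ?_, h0, _,
    isBetaExpansion_expansion h0 (tailVal_lt_one hβ.one_lt ε 0), 1, fun k hk1 => ?_⟩
  · rw [mk_eq_mk_iff hβ, ← h, phiZero_eq hβ]
    have h1 := pisotHom_unst hβ (realCode_shift_mem_kerLattice hβ hk 0)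
    have h2 : (fun k => ε.1 (k + 0)) = ε.1 := funext fun k => by rw [add_zero]
    simp only [unst_realCode_shift hβ] at h1
    rw [h1, h2]
  · obtain ⟨n, rfl⟩ : ∃ n : ℕ, k = 1 + n := ⟨(k - 1).toNat, by omega⟩
    rw [expansion_one_add, digit_tailVal hβ.one_lt, zero_add]

lemma pow_mul_sub_orbit_mem (hβ : 1 < β) {x : ℝ} (hx : 0 ≤ x) (n : ℕ) :
    β ^ n * x - orbit β x n ∈ ringZ β := by
  induction n with
  | zero => simp [orbit_zero, zero_mem]
  | succ n ih =>
    rw [mem_ringZ] at ih ⊢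
    have h := add_mem (mul_mem (self_mem_adjoin β) ih)
      (natCast_mem (Algebra.adjoin ℤ ({β} : Set ℝ)) (digit β x n))
    rw [orbit_succ_eq hβ hx]
    convert h using 1
    ring

/-- Once the digits agree, the tail value is the greedy remainder of `ξ βⁿ`, and the part removed is
an integral polynomial in `β`. -/
lemma tailVal_sub_mem (hβ : IsPisotUnit β) {ε δ : ℤ → ℕ} {ξ : ℝ} (hδ : IsBetaExpansion β ξ δ)
    (n : ℕ) (hK : ∀ k > (n : ℤ), ε k = δ k) : ξ * β ^ n - tailVal β ε n ∈ ringZ β := by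
  obtain ⟨N, h0, h1, h2, -⟩ := hδ
  have hpow : 0 < β ^ N := pow_pos (pos hβ) N
  have hx : 0 ≤ ξ / β ^ N := div_nonneg h0 hpow.le
  have hx1 : ξ / β ^ N < 1 := (div_lt_one hpow).2 h1
  have e : tailVal β ε n = orbit β (ξ / β ^ N) (n + N) := by
    rw [← val_digit hβ.one_lt (orbit_nonneg hx (n + N)) (orbit_lt_one hx1 (n + N)), tailVal]
    congr 1
    funext i
    rw [← digit_add, ← h2, hK _ (by omega)]
    congr 1
    push_cast
    ring
  have h := pow_mul_sub_orbit_mem hβ.one_lt hx (n + N)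
  rw [e]
  convert h using 2
  rw [pow_add]
  field_simp

lemma tendsto_toralMap_of_tail (hβ : IsPisotUnit β) {ε : compactum β} {ξ : pisotP β} {δ : ℤ → ℕ}
    (hδ : IsBetaExpansion β ξ δ) (n : ℕ) (hK : ∀ k > (n : ℤ), ε.1 k = δ k) :
    Tendsto (fun i : ℕ => toralMap (companion β ^ (i : ℤ)) (phiZero β ε - pisotHom hβ ξ))
      atTop (𝓝 0) := by
  obtain ⟨u, -, hu, hq⟩ := exists_pisotHom_eq hβ ξ
  obtain ⟨z, hz⟩ := exists_unst_eq hβ (tailVal_sub_mem hβ hδ n hK)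
  -- The integer vector `z` compensates the difference of the unstable components, so `w` is stable.
  set w := (realCode β fun k => ε.1 (k + n)) - act (companion β ^ (n : ℤ)) u + intVec z with hw
  have hw0 : unst β w = 0 := by
    rw [hw, map_add, map_sub, unst_realCode_shift hβ, unst_zpow hβ, hu, hz, zpow_natCast]
    ring
  have hwt : torusMk w = toralMap (companion β ^ (n : ℤ)) (phiZero β ε - pisotHom hβ ξ) := by
    rw [hw, map_add, map_sub, torusMk_intVec, add_zero, torusMk_realCode_shift hβ (compactum_le ε),
      ← toralMap_torusMk, ← phiZero_eq hβ, ← hq]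
    exact (map_sub (toralHom _) _ _).symm
  rw [← tendsto_add_atTop_iff_nat n]
  have h := (continuous_torusMk.tendsto 0).comp (tendsto_act_of_unst_eq_zero hβ hw0)
  rw [map_zero] at h
  refine h.congr fun i => ?_
  rw [Function.comp, ← toralMap_torusMk, hwt, ← zpow_natCast, ← toralMap_zpow_add hβ]
  push_cast
  rfl

lemma toralMap_period (hβ : IsPisotUnit β) {ε : compactum β} {p : ℕ}
    (hp : ∀ k : ℤ, ε.1 (k + p) = ε.1 k) (i : ℕ) :
    toralMap (companion β ^ ((p * i : ℕ) : ℤ)) (phiZero β ε) = phiZero β ε := by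
  have hper : ∀ (i : ℕ) (k : ℤ), ε.1 (k + (p * i : ℕ)) = ε.1 k := by
    intro i
    induction i with
    | zero => simp
    | succ i ih =>
      intro k
      rw [← ih k, ← hp (k + (p * i : ℕ))]
      exact congrArg ε.1 (by push_cast; ring)
  rw [phiZero_eq hβ, ← torusMk_realCode_shift hβ (compactum_le ε)]
  simp only [hper]

lemma phiZero_eq_of_periodic (hβ : IsPisotUnit β) {ε : compactum β} {ξ : pisotP β} {p : ℕ}
    (hp0 : 0 < p) (hp : ∀ k : ℤ, ε.1 (k + p) = ε.1 k) {δ : ℤ → ℕ} (hδ : IsBetaExpansion β ξ δ)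
    {K : ℤ} (hK : ∀ k ≥ K, ε.1 k = δ k) : phiZero β ε = pisotHom hβ ξ := by
  set y := phiZero β ε
  set z := pisotHom hβ ξ
  have ht := (tendsto_toralMap_of_tail hβ hδ K.toNat fun k hk => hK k (by omega)).comp
    (tendsto_id.const_mul_atTop' hp0)
  -- Along multiples of the period `φ₀(ε)` is fixed, while the image of `pisotHom ξ` stays in the
  -- finite kernel. A sequence in the finite set `S` that tends to `0` must reach it.
  set S : Set (Torus β) := (fun θ => y - θ) '' {θ | toralHom (derivMat β) θ = 0}
  have hS : S.Finite := (finite_ker_derivMat hβ).image _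
  have hmem : ∀ i : ℕ, toralMap (companion β ^ ((p * i : ℕ) : ℤ)) (y - z) ∈ S := by
    intro i
    refine ⟨toralMap (companion β ^ ((p * i : ℕ) : ℤ)) z, ?_, ?_⟩
    · rw [Set.mem_ofPred_eq, toralHom_derivMat_zpow, toralHom_pisotHom]
      exact map_zero (toralHom _)
    · have := map_sub (toralHom (companion β ^ ((p * i : ℕ) : ℤ))) y z
      rw [toralHom_apply, toralHom_apply, toralHom_apply, toralMap_period hβ hp] at this
      exact this.symm
  have hopen : (S \ {0})ᶜ ∈ 𝓝 (0 : Torus β) :=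
    (hS.subset Set.sdiff_subset).isClosed.isOpen_compl.mem_nhds (by simp)
  obtain ⟨i, hi⟩ := (ht.eventually hopen).exists
  have h0 : toralMap (companion β ^ ((p * i : ℕ) : ℤ)) (y - z) = 0 := by
    by_contra hne
    exact hi ⟨hmem i, hne⟩
  have h1 : toralMap (companion β ^ ((p * i : ℕ) : ℤ)) 0 = 0 := map_zero (toralHom _)
  exact sub_eq_zero.1 (toralMap_zpow_injective hβ _ (h0.trans h1.symm))

lemma mem_symbolicClass_iff (hβ : IsPisotUnit β) (ε : compactum β) (ξ : pisotP β) :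
    ε ∈ symbolicClass β (QuotientAddGroup.mk ξ) ↔ phiZero β ε = pisotHom hβ ξ := by
  refine ⟨?_, mem_symbolicClass_of_phiZero_eq hβ⟩
  rintro ⟨⟨p, hp0, hp⟩, η, hη, -, δ, hδ, K, hK⟩
  rw [phiZero_eq_of_periodic hβ hp0 hp hδ hK]
  exact (mk_eq_mk_iff hβ η ξ).1 hη

/-- The bijection `X'_β → 𝕋^m` induced by `φ₀`. -/
noncomputable def codingEquiv (hβ : IsPisotUnit β) : QuotientCompactum β ≃ Torus β :=
  Setoid.quotientKerEquivOfSurjective (phiZero β) (phiZero_surjective hβ)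

lemma codingEquiv_toQuotient (hβ : IsPisotUnit β) (ε : compactum β) :
    codingEquiv hβ (toQuotient β ε) = phiZero β ε := rfl

end PisotCoding

open PisotCoding

/-- The group structure on `X'_β` is the one carried over from the torus: it is determined by the
requirement that the bijection `e` induced by `φ₀` be a group isomorphism. -/
theorem theorem3p1 (β : ℝ) (hβ : IsPisotUnit β) (hfin : IsFinitary β) :
    -- the series that define `φ₀` and `φ` converge
    (∀ ε : compactum β,
      Summable (codingTerm β (xiZero β) ε) ∧ Summable (codingTerm β 1 ε)) ∧
    -- `φ` is well defined on the quotient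
    (∀ ε ε' : compactum β, phiZero β ε = phiZero β ε' → phi β ε = phi β ε') ∧
    ∃ (_ : AddCommGroup (QuotientCompactum β)) (e : QuotientCompactum β ≃+ Torus β),
      (∀ ε, e (toQuotient β ε) = phiZero β ε) ∧
      -- the induced map is a homomorphism, with kernel the symbolic Pisot group
      ∃ Φ : QuotientCompactum β →+ Torus β,
        (∀ ε, Φ (toQuotient β ε) = phi β ε) ∧
        classSet β '' (Φ.ker : Set (QuotientCompactum β)) = symbolicPisotGroup β ∧
        -- the group structure that the symbolic Pisot group inherits from the Pisot group through
        -- the bijection `g` is that of the kernel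
        ∃ γ : PisotGroup β ≃+ Φ.ker,
          ∀ a, classSet β (γ a : QuotientCompactum β) = symbolicClass β a := by
  refine ⟨fun ε => ⟨(hasSum_phiZero hβ ε).summable, (hasSum_phi hβ ε).summable⟩,
    fun ε ε' h => by rw [phi_eq hβ, phi_eq hβ, h], (codingEquiv hβ).addCommGroup, ?_⟩
  let _ := (codingEquiv hβ).addCommGroup
  let e : QuotientCompactum β ≃+ Torus β := (codingEquiv hβ).addEquiv
  have he : ∀ ε, e (toQuotient β ε) = phiZero β ε := fun ε => codingEquiv_toQuotient hβ ε
  let Φ : QuotientCompactum β →+ Torus β := (toralHom (derivMat β)).comp e.toAddMonoidHom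
  have hΦ : ∀ x, Φ x = toralHom (derivMat β) (e x) := fun _ => rfl
  refine ⟨e, he, Φ, fun ε => by rw [hΦ, he, phi_eq hβ], ?_⟩
  let f : pisotP β →+ Φ.ker := (e.symm.toAddMonoidHom.comp (pisotHom hβ)).codRestrict Φ.ker
    fun ξ => by
      rw [AddMonoidHom.mem_ker, hΦ]
      exact (congrArg _ (e.apply_symm_apply _)).trans (toralHom_pisotHom hβ ξ)
  have hf : ∀ ξ, e (f ξ : QuotientCompactum β) = pisotHom hβ ξ := fun ξ => e.apply_symm_apply _
  have hker : (ringZ β).addSubgroupOf (pisotP β) ≤ f.ker := fun ξ hξ => by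
    rw [AddMonoidHom.mem_ker]
    apply Subtype.ext
    apply e.injective
    rw [hf]
    exact ((pisotHom_eq_zero_iff hβ ξ).2 hξ).trans (map_zero e).symm
  let F : PisotGroup β →+ Φ.ker := QuotientAddGroup.lift _ f hker
  have hF : Function.Bijective F := by
    constructor
    · intro a b
      obtain ⟨ξ, rfl⟩ := QuotientAddGroup.mk_surjective a
      obtain ⟨η, rfl⟩ := QuotientAddGroup.mk_surjective b
      intro h
      rw [mk_eq_mk_iff hβ, ← hf, ← hf]
      exact congrArg (fun x : Φ.ker => e x) h
    · rintro ⟨x, hx⟩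
      -- A preimage of a kernel element is the unstable component of any lift of its torus point.
      obtain ⟨u, hu⟩ := torusMk_surjective (e x)
      have hmem : u ∈ kerLattice β := by
        change toralHom (derivMat β) (torusMk u) = 0
        rw [hu]
        exact hx
      refine ⟨QuotientAddGroup.mk ⟨unst β u, unst_mem_pisotP hβ hmem⟩, ?_⟩
      apply Subtype.ext
      apply e.injective
      exact (hf _).trans ((pisotHom_unst hβ hmem).trans hu)
  have hclass : ∀ a, classSet β (F a : QuotientCompactum β) = symbolicClass β a := by
    intro a
    obtain ⟨ξ, rfl⟩ := QuotientAddGroup.mk_surjective a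
    ext ε
    rw [mem_symbolicClass_iff hβ, ← he, ← hf]
    exact e.injective.eq_iff.symm
  refine ⟨?_, AddEquiv.ofBijective F hF, hclass⟩
  ext s
  constructor
  · rintro ⟨x, hx, rfl⟩
    obtain ⟨a, ha⟩ := hF.2 ⟨x, hx⟩
    exact ⟨a, by rw [← hclass, ha]⟩
  · rintro ⟨a, rfl⟩
    exact ⟨F a, (F a).2, hclass a⟩
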